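/- Let $0\le\epsilon<1$ and $k\ge 1$. A source generates at each time $t=0,1,2,\dots$ an independent symbol, uniform on $\mathbb F_q^k$, where $q$ is a prime power. At each such time there is also one use of the $q$-ary erasure channel without feedback: a sent symbol of $\mathbb F_q$ is received instantaneously, or erased with probability $\epsilon$, independently over the channel uses. For $n\ge k$, an $(n,k)$-scheme $\mathcal C$ consists of generator matrices $\mathbf G_l\in\mathbb F_q^{k\times n}$ ($l=0,1,\dots$) and a decoder. The source symbol $\mathbf u$ generated at time $ln$ is transmitted as $\mathbf u^T\mathbf G_l$ during the channel uses $ln,\dots,ln+n-1$, and all other source symbols are discarded. At every channel use the decoder outputs, as a function of the channel outputs so far, either nothing or the index and value of a source symbol, and it never outputs a wrong value. The age at time $t$ is $\Delta_{\epsilon,\mathcal C}(t)=t-u(t)$, where $u(t)$ is the generation time of the freshest symbol decoded by time $t$ (initially $-n$), and the average age $\Delta_{\epsilon,\mathcal C}$ is the almost sure constant value of $\lim_{\tau\to\infty}\frac1\tau\int_0^\tau\Delta_{\epsilon,\mathcal C}(t)\,dt$. The optimal average age $\Delta_\epsilon$ (for given $k$ and $q$) is the infimum of the average ages of all $(n,k)$-schemes,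 $n\ge k$, that have one. In the random $(n,k)$-code all columns of all matrices $\mathbf G_l$ are independent and uniform on $\mathbb F_q^k\setminus\{0\}$, and a message is decoded as soon as $k$ linearly independent coded symbols of its block have been received. Let $\Delta_{\epsilon,(n,k)}=\mathbb E(\Delta_{\epsilon,\mathcal C})$ be the expectation over the random code $\mathcal C$. Let $\tilde B$ and $\tilde{\tilde B}$ be sums of $k$ and of $k+1$ independent geometric random variables on $\{1,2,\dots\}$ with success probability $1-\epsilon$, and let $$\Delta^{lb}_{\epsilon,(n,k)}=\frac{2n(1-\epsilon)-(1-\epsilon)\,\mathbb P(\tilde B\le n)(n+2)+2k\,\mathbb P(\tilde{\tilde B}\le n+1)}{2(1-\epsilon)\,\mathbb P(\tilde B\le n)}.$$ Theorem. (1) For every $q$ and every $n\ge k$, almost every realization $\mathcal C$ of the random $(n,k)$-code has an average age, and $\Delta_{\epsilon,\mathcal C}=\Delta_{\epsilon,(n,k)}$. (2) For every $n\ge k$ and every $\delta>0$ there is $q_0>0$ such that for all prime powers $q\ge q_0$, almost every realization $\mathcal C$ of the random $(n,k)$-code satisfies $|\Delta_{\epsilon,\mathcal C}-\Delta^{lb}_{\epsilon,(n,k)}|<\delta$;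 in particular such a code exists, and $|\Delta_{\epsilon,(n,k)}-\Delta^{lb}_{\epsilon,(n,k)}|<\delta$. (3) Random codes are asymptotically age-optimal: for every $\delta>0$ there is $q_0>0$ such that for all prime powers $q\ge q_0$ the minimum $\min_{n\ge k}\Delta_{\epsilon,(n,k)}$ is attained and $\bigl|\Delta_\epsilon-\min_{n\ge k}\Delta_{\epsilon,(n,k)}\bigr|<\delta$. -/

import Mathlib

open MeasureTheory ProbabilityTheory Filter Topology

noncomputable section

namespace AgeErasure

/-- A coding scheme with blocklength `n` for source symbols in `F ^ k`, induced by linear codes.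
There is one channel use and one new source symbol at each of the times `0, 1, 2, …`. The symbol
generated at time `l * n` is the `l`-th transmitted message; it is encoded by an arbitrary linear
code with the `k × n` generator matrix `G_l = [col (l * n), …, col (l * n + n - 1)]`, whose coded
symbols are sent at the times `l * n, …, l * n + n - 1`. Source symbols generated in between
are discarded.

At channel use `i` the decoder sees all channel outputs so far (`none` is the erasure symbol) and
outputs either `none` or the index (generation time) and an estimate of a source symbol. -/
structure Scheme (F : Type*) (n k : ℕ) where
  /-- column of the generator matrix that is used at channel use `i` -/
  col : ℕ → Fin k → F
  /-- decoder at channel use `i` -/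
  dec : (i : ℕ) → (Fin (i + 1) → Option F) → Option (ℕ × (Fin k → F))

section Model

variable {F : Type*} [Field F] {n k : ℕ}

/-- Channel input at channel use `i`, when `u t` is the source symbol generated at time `t`. -/
def Scheme.channelInput (S : Scheme F n k) (u : ℕ → Fin k → F) (i : ℕ) : F :=
  u (i / n * n) ⬝ᵥ S.col i

/-- Channel output at channel use `i`, when `e` is the erasure pattern (`true` is an erasure). -/
def Scheme.channelOutput (S : Scheme F n k) (u : ℕ → Fin k → F) (e : ℕ → Bool) (i : ℕ) :
    Option F :=
  if e i = true then none else some (S.channelInput u i)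

/-- What the decoder of the scheme outputs at channel use `i`. -/
def Scheme.decoded (S : Scheme F n k) (u : ℕ → Fin k → F) (e : ℕ → Bool) (i : ℕ) :
    Option (ℕ × (Fin k → F)) :=
  S.dec i fun m => S.channelOutput u e m

/-- The decoder never outputs a wrong message: the error probability is zero. -/
def Scheme.ZeroError (S : Scheme F n k) : Prop :=
  ∀ (u : ℕ → Fin k → F) (e : ℕ → Bool) (i j : ℕ) (w : Fin k → F),
    S.decoded u e i = some (j, w) → w = u j

/-- Generation time of the freshest message decoded during the channel uses `0, …, N - 1`.
Observation begins right after a successful block, which started at time `-n`. -/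
def Scheme.freshest (S : Scheme F n k) (u : ℕ → Fin k → F) (e : ℕ → Bool) : ℕ → ℤ
  | 0 => -(n : ℤ)
  | N + 1 =>
    match S.decoded u e N with
    | none => S.freshest u e N
    | some (j, _) => max (S.freshest u e N) (j : ℤ)

/-- Instantaneous age at the real time `t ≥ 0`; the channel uses up to time `t` are those with
index at most `⌊t⌋₊`, since symbols are received instantaneously. -/
def Scheme.age (S : Scheme F n k) (u : ℕ → Fin k → F) (e : ℕ → Bool) (t : ℝ) : ℝ :=
  t - (S.freshest u e (⌊t⌋₊ + 1) : ℝ)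

end Model

/-- Law of the source: i.i.d. symbols, uniform on `F ^ k`. -/
def sourceLaw (F : Type*) [MeasurableSpace F] (k : ℕ) : Measure (ℕ → Fin k → F) :=
  Measure.infinitePi fun _ => uniformOn Set.univ

/-- Law of the erasures: i.i.d., each channel use is erased with probability `ε`. -/
def erasureLaw (ε : unitInterval) : Measure (ℕ → Bool) :=
  Measure.infinitePi fun _ => bernoulliMeasure true false ε

section Age

variable {F : Type*} [Field F] [MeasurableSpace F] {n k : ℕ}

/-- The average age of the scheme `S` over the erasure channel exists almost surely and is `D`. -/
def HasAverageAge (ε : unitInterval) (S : Scheme F n k) (D : ℝ) : Prop :=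
  ∀ᵐ p ∂((sourceLaw F k).prod (erasureLaw ε)),
    Tendsto (fun τ : ℝ => 1 / τ * ∫ t in (0 : ℝ)..τ, S.age p.1 p.2 t) atTop (𝓝 D)

open Classical in
/-- The average age of a scheme (`0` by convention if there is none). -/
def averageAge (ε : unitInterval) (S : Scheme F n k) : ℝ :=
  if h : ∃ D, HasAverageAge ε S D then h.choose else 0

end Age

/-- Law of the random code: all columns of all generator matrices are independent and uniform on
the nonzero vectors of `F ^ k`. -/
def randomCode (F : Type*) [Field F] [MeasurableSpace F] (k : ℕ) : Measure (ℕ → Fin k → F) :=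
  Measure.infinitePi fun _ => uniformOn {v : Fin k → F | v ≠ 0}

open Classical in
/-- The scheme with columns `g` and decoding on the fly: as soon as the columns of the unerased
symbols of the current block have rank `k`, the decoder solves the linear system for the message;
until then it outputs nothing. -/
def onTheFly {F : Type*} [Field F] {k : ℕ} (n : ℕ) (g : ℕ → Fin k → F) : Scheme F n k where
  col := g
  dec i y :=
    if h : Submodule.span F
          {v | ∃ m : Fin (i + 1), (m : ℕ) / n = i / n ∧ y m ≠ none ∧ v = g m} = ⊤ ∧
        ∃ w : Fin k → F, ∀ m : Fin (i + 1), (m : ℕ) / n = i / n →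
          ∀ z : F, y m = some z → w ⬝ᵥ g m = z
    then some (i / n * n, h.2.choose)
    else none

/-- Expected average age of the random `(n, k)`-scheme. -/
def randomCodeAge (ε : unitInterval) (F : Type*) [Field F] [MeasurableSpace F] (n k : ℕ) : ℝ :=
  ∫ g, averageAge ε (onTheFly n g) ∂(randomCode F k)

/-- The average ages achieved, without decoding errors, by the schemes that are induced by linear
`(n, k)`-codes of some blocklength `n ≥ k`; the optimal average age is the infimum of this set. -/
def achievedAges (ε : unitInterval) (F : Type*) [Field F] [MeasurableSpace F] (k : ℕ) : Set ℝ :=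
  {D | ∃ n, k ≤ n ∧ ∃ S : Scheme F n k, S.ZeroError ∧ HasAverageAge ε S D}

/-- Law of the sum of `m` independent random variables that are geometric on `{1, 2, …}` with
success probability `p` (Mathlib's geometric law counts the failures, hence the `+ 1`). -/
def geometricSum (m : ℕ) (p : unitInterval) : Measure ℕ :=
  (Measure.pi fun _ : Fin m => geometricMeasure p).map fun L => ∑ i, (L i + 1)

/-- The lower bound on the average age that corresponds to MDS codes. -/
def ageLowerBound (ε : unitInterval) (n k : ℕ) : ℝ :=
  let a : ℝ := (geometricSum k (unitInterval.symm ε)).real (Set.Iic n)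
  let b : ℝ := (geometricSum (k + 1) (unitInterval.symm ε)).real (Set.Iic (n + 1))
  (2 * n * (1 - ε) - (1 - ε) * a * (n + 2) + 2 * k * b) / (2 * (1 - ε) * a)

end AgeErasure

end

namespace AgeErasure

/-! ### Functions of finitely many coordinates of an i.i.d. sequence -/

section Independence

variable {Y : Type*}

/-! Suppose a decoder settles the message of the current block on the fly, by a test that depends
only on the symbols of that block. Let `A l` be the number of blocks since the last decoded one
(`runLength`), and `c l` the number of channel uses of block `l` before decoding. The age is
measured from the start of the current block once that is decoded, and from `A l` blocks earlier
until then, so `N` blocks have total age `N n² / 2 + n ∑ A l * c l` (`sum_freshestOf`). Blocks are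
i.i.d. and `A l` depends only on earlier ones. A strong law, `ae_tendsto_sum_runLength_mul_div`,
gives `∑ A l * c l ~ N E[c] / p`, where `p` is the probability of decoding a block. Hence the
average age is `ageOfCdf n R`, where `R m` is the probability of decoding within `m` channel uses
(`ae_tendsto_average_blockTest`).

For an ideal decoder that needs exactly `k` unerased symbols, `R` is the distribution function of a
sum of `k` geometric variables, and `ageOfCdf` becomes the closed formula `ageLowerBound`
(`ageLowerBound_eq`). For the random code, `R` is smaller by at most `m / q`, since a new column
falls into a given proper subspace with probability at most `1 / q`
(`waitCdf_le_decodableProb_add`). Continuity of `ageOfCdf` gives convergence for large `q`.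

Conversely, a zero-error decoder cannot output a symbol before `k` unerased uses of its block, so on
every erasure pattern it is at least as old as the ideal one (`freshest_le`, `ageLowerBound_le`). As
the bound is at least `n / 2`, it has a minimiser `n₀`, and one alphabet size that is good for `n₀`
settles the optimality claim. -/

theorem dependsOn_comp_shift {β : Type*} {f : (ℕ → Y) → β} {n : ℕ}
    (hf : DependsOn f (Set.Iio n)) (M : ℕ) :
    DependsOn (fun ω : ℕ → Y => f fun i => ω (M + i)) (Set.Ico M (M + n)) := by
  intro x y hxy
  exact hf fun i hi => hxy _ ⟨Nat.le_add_right _ _, Nat.add_lt_add_left hi M⟩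

theorem dependsOn_comp_shift_Iio {β : Type*} {f : (ℕ → Y) → β} {n : ℕ}
    (hf : DependsOn f (Set.Iio n)) (M : ℕ) :
    DependsOn (fun ω : ℕ → Y => f fun i => ω (M + i)) (Set.Iio (M + n)) :=
  (dependsOn_comp_shift hf M).mono fun _ hi => hi.2

theorem DependsOn.comp₂ {β γ δ : Type*} {f : (ℕ → Y) → β} {g : (ℕ → Y) → γ} {S : Set ℕ}
    (hf : DependsOn f S) (hg : DependsOn g S) (φ : β → γ → δ) :
    DependsOn (fun ω => φ (f ω) (g ω)) S := by
  intro x y hxy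
  simp only [hf hxy, hg hxy]

variable [MeasurableSpace Y] {ν : Measure Y} [IsProbabilityMeasure ν]

theorem measurable_domRestrict_coe (S : Finset ℕ) :
    Measurable ((S : Set ℕ).domRestrict (π := fun _ => Y)) :=
  measurable_pi_lambda _ fun _ => measurable_pi_apply _

theorem map_shift_infinitePi (M : ℕ) :
    (Measure.infinitePi fun _ : ℕ => ν).map (fun ω i => ω (M + i)) =
      Measure.infinitePi fun _ : ℕ => ν :=
  Measure.map_infinitePi_infinitePi_of_inj (P := fun _ : ℕ => ν) (f := fun i => M + i)
    (add_right_injective M)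

variable [DiscreteMeasurableSpace Y] [Finite Y]

/-- A function of finitely many coordinates factors through a finite discrete space. Thus
measurability, integrability and independence cost nothing for the block functionals below. -/
theorem measurable_of_dependsOn_finset {f : (ℕ → Y) → ℝ} {S : Finset ℕ} (hf : DependsOn f S) :
    Measurable f := by
  obtain ⟨g, rfl⟩ := dependsOn_iff_exists_comp.1 hf
  exact (measurable_of_countable g).comp (measurable_domRestrict_coe S)

theorem measurable_of_dependsOn {f : (ℕ → Y) → ℝ} {M : ℕ} (hf : DependsOn f (Set.Iio M)) :
    Measurable f :=
  measurable_of_dependsOn_finset (S := Finset.range M) (by simpa using hf)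

theorem integrable_of_dependsOn {f : (ℕ → Y) → ℝ} {M : ℕ} (hf : DependsOn f (Set.Iio M)) :
    Integrable f (Measure.infinitePi fun _ : ℕ => ν) := by
  have hf' : DependsOn f (Finset.range M : Set ℕ) := by simpa using hf
  obtain ⟨g, rfl⟩ := dependsOn_iff_exists_comp.1 hf'
  have hm := measurable_domRestrict_coe (Y := Y) (Finset.range M)
  have := Measure.isFiniteMeasure_map (Measure.infinitePi fun _ : ℕ => ν)
    ((Finset.range M : Set ℕ).domRestrict (π := fun _ => Y))
  exact Integrable.comp_measurable (Integrable.of_finite (f := g)) hm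

theorem indepFun_of_dependsOn {f h : (ℕ → Y) → ℝ} {S T : Finset ℕ} (hST : Disjoint S T)
    (hf : DependsOn f S) (hh : DependsOn h T) :
    IndepFun f h (Measure.infinitePi fun _ : ℕ => ν) := by
  obtain ⟨g, rfl⟩ := dependsOn_iff_exists_comp.1 hf
  obtain ⟨g', rfl⟩ := dependsOn_iff_exists_comp.1 hh
  have h0 : iIndepFun (fun (i : ℕ) (ω : ℕ → Y) => ω i) (Measure.infinitePi fun _ : ℕ => ν) :=
    iIndepFun_infinitePi (P := fun _ : ℕ => ν) (X := fun _ x => x) fun _ => measurable_id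
  have h1 := h0.indepFun_finset S T hST fun i => measurable_pi_apply i
  exact h1.comp (measurable_of_countable g) (measurable_of_countable g')

theorem integral_shift {h : (ℕ → Y) → ℝ} {n : ℕ} (hh : DependsOn h (Set.Iio n)) (M : ℕ) :
    ∫ ω, h (fun i => ω (M + i)) ∂(Measure.infinitePi fun _ : ℕ => ν) =
      ∫ ω, h ω ∂(Measure.infinitePi fun _ : ℕ => ν) := by
  conv_rhs => rw [← map_shift_infinitePi (ν := ν) M]
  rw [integral_map]
  · exact (measurable_pi_lambda _ fun i => measurable_pi_apply _).aemeasurable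
  · exact (measurable_of_dependsOn hh).aestronglyMeasurable

/-- The form in which independence is used throughout: `f` sees the past up to `M`, the shifted `h`
sees the next `n` coordinates, and stationarity removes the shift. -/
theorem integral_mul_shift {f h : (ℕ → Y) → ℝ} {M n : ℕ} (hf : DependsOn f (Set.Iio M))
    (hh : DependsOn h (Set.Iio n)) :
    ∫ ω, f ω * h (fun i => ω (M + i)) ∂(Measure.infinitePi fun _ : ℕ => ν) =
      (∫ ω, f ω ∂(Measure.infinitePi fun _ : ℕ => ν)) *
        ∫ ω, h ω ∂(Measure.infinitePi fun _ : ℕ => ν) := by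
  rw [← integral_shift hh M]
  have h1 : DependsOn f (Finset.range M : Set ℕ) := by simpa using hf
  have h2 : DependsOn (fun ω : ℕ → Y => h fun i => ω (M + i))
      (Finset.Ico M (M + n) : Set ℕ) := by simpa using dependsOn_comp_shift hh M
  refine (indepFun_of_dependsOn ?_ h1 h2).integral_fun_mul_eq_mul_integral
    (measurable_of_dependsOn hf).aestronglyMeasurable
    (measurable_of_dependsOn_finset h2).aestronglyMeasurable
  rw [Finset.disjoint_left]
  intro a ha hb
  simp at ha hb
  lia

end Independence

/-! ### A strong law for rewards weighted with the time since the last success -/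

/-- Number of rounds since the last success, if `s l` is `1` when round `l` is a success and `0`
otherwise; round `-1` counts as a success. -/
def runLength (s : ℕ → ℝ) : ℕ → ℝ
  | 0 => 1
  | l + 1 => 1 + (1 - s l) * runLength s l

/-- The recursion says that run lengths increase by `1 - runLength s l * s l`, so the sum
telescopes. This identity replaces renewal theory. -/
theorem sum_runLength_mul (s : ℕ → ℝ) (N : ℕ) :
    ∑ l ∈ Finset.range N, runLength s l * s l = N + 1 - runLength s N := by
  induction N with
  | zero => simp [runLength]
  | succ N ih =>
    rw [Finset.sum_range_succ, ih, runLength]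
    push_cast
    ring

theorem runLength_nonneg {s : ℕ → ℝ} (hs : ∀ l, s l ≤ 1) (l : ℕ) : 0 ≤ runLength s l := by
  induction l with
  | zero => simp [runLength]
  | succ l ih =>
    have := mul_nonneg (sub_nonneg.2 (hs l)) ih
    simp only [runLength]
    linarith

/-- The sum of all `f m` has finite integral, so it is finite almost everywhere and its terms tend
to `0`. -/
theorem ae_tendsto_zero_of_integral_le {Ω : Type*} [MeasurableSpace Ω] {P : Measure Ω}
    {f : ℕ → Ω → ℝ} {b : ℕ → ℝ} (h0 : ∀ m ω, 0 ≤ f m ω) (hi : ∀ m, Integrable (f m) P)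
    (hfb : ∀ m, ∫ ω, f m ω ∂P ≤ b m) (hb : Summable b) :
    ∀ᵐ ω ∂P, Tendsto (fun m => f m ω) atTop (𝓝 0) := by
  have hb0 : ∀ m, 0 ≤ b m := fun m => (integral_nonneg (h0 m)).trans (hfb m)
  have h1 : ∫⁻ ω, ∑' m, ENNReal.ofReal (f m ω) ∂P ≠ ⊤ := by
    rw [lintegral_tsum fun m => (hi m).aestronglyMeasurable.aemeasurable.ennreal_ofReal]
    refine ne_top_of_le_ne_top (b := ∑' m, ENNReal.ofReal (b m)) ?_ (ENNReal.tsum_le_tsum fun m => ?_)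
    · rw [← ENNReal.ofReal_tsum_of_nonneg hb0 hb]
      exact ENNReal.ofReal_ne_top
    · rw [← ofReal_integral_eq_lintegral_ofReal (hi m) (Eventually.of_forall (h0 m))]
      exact ENNReal.ofReal_le_ofReal (hfb m)
  have h2 := ae_lt_top' (AEMeasurable.tsum fun m =>
    (hi m).aestronglyMeasurable.aemeasurable.ennreal_ofReal) h1
  filter_upwards [h2] with ω hω
  have h3 := ENNReal.tendsto_atTop_zero_of_tsum_ne_top hω.ne
  have h4 := (ENNReal.tendsto_toReal ENNReal.zero_ne_top).comp h3
  refine (by simpa using h4 : Tendsto _ _ _).congr fun m => ?_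
  simp [ENNReal.toReal_ofReal (h0 m ω)]

/-- Consecutive squares have ratio tending to `1`, so monotonicity fills the gaps between them. -/
theorem tendsto_div_of_tendsto_sq_div {u : ℕ → ℝ} {l : ℝ} (hu : Monotone u)
    (h : Tendsto (fun m : ℕ => u (m ^ 2) / (m : ℝ) ^ 2) atTop (𝓝 l)) :
    Tendsto (fun N : ℕ => u N / N) atTop (𝓝 l) := by
  refine tendsto_div_of_monotone_of_exists_subseq_tendsto_div u l hu fun a ha =>
    ⟨fun m => m ^ 2, ?_, tendsto_pow_atTop two_ne_zero, by simpa using h⟩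
  have h1 : Tendsto (fun m : ℕ => (1 + 1 / (m : ℝ)) ^ 2) atTop (𝓝 1) := by
    simpa using (tendsto_one_div_atTop_nhds_zero_nat (𝕜 := ℝ)).const_add 1 |>.pow 2
  filter_upwards [h1.eventually (gt_mem_nhds ha), eventually_gt_atTop 0] with m hm hm0
  have hm0' : (0 : ℝ) < m := by exact_mod_cast hm0
  have : ((m + 1 : ℕ) : ℝ) ^ 2 = (1 + 1 / (m : ℝ)) ^ 2 * m ^ 2 := by
    push_cast
    field_simp
  push_cast at this ⊢
  rw [this]
  gcongr

section StrongLaw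

variable {Y : Type*}

/-- The value of `f` in the `l`-th block of length `n`. -/
def onBlock {Y β : Type*} (n : ℕ) (f : (ℕ → Y) → β) (ω : ℕ → Y) (l : ℕ) : β :=
  f fun i => ω (l * n + i)

theorem dependsOn_onBlock {β : Type*} {n : ℕ} {f : (ℕ → Y) → β} (hf : DependsOn f (Set.Iio n))
    (l : ℕ) : DependsOn (fun ω => onBlock n f ω l) (Set.Iio ((l + 1) * n)) := by
  have := dependsOn_comp_shift_Iio hf (l * n)
  rwa [← Nat.succ_mul] at this

theorem dependsOn_runLength {n : ℕ} {s : (ℕ → Y) → ℝ} (hs : DependsOn s (Set.Iio n)) (l : ℕ) :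
    DependsOn (fun ω => runLength (onBlock n s ω) l) (Set.Iio (l * n)) := by
  induction l with
  | zero => intro x y _; rfl
  | succ l ih =>
    have h1 := ih.mono (t := Set.Iio ((l + 1) * n))
      (Set.Iio_subset_Iio (Nat.mul_le_mul_right n l.le_succ))
    exact DependsOn.comp₂ h1 (dependsOn_onBlock hs l) fun a b => 1 + (1 - b) * a

theorem dependsOn_sum_runLength_mul {n : ℕ} {s h : (ℕ → Y) → ℝ} (hs : DependsOn s (Set.Iio n))
    (hh : DependsOn h (Set.Iio n)) (N : ℕ) :
    DependsOn (fun ω => ∑ l ∈ Finset.range N, runLength (onBlock n s ω) l * onBlock n h ω l)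
      (Set.Iio (N * n)) := by
  intro x y hxy
  refine Finset.sum_congr rfl fun l hl => ?_
  have hl' : (l + 1) * n ≤ N * n := Nat.mul_le_mul_right n (by simpa using hl)
  have hl'' : l * n ≤ N * n := Nat.mul_le_mul_right n (by simp at hl; lia)
  have h1 := dependsOn_runLength hs l fun i hi => hxy i (lt_of_lt_of_le hi hl'')
  have h2 := dependsOn_onBlock hh l fun i hi => hxy i (lt_of_lt_of_le hi hl')
  simp only at h1 h2
  rw [h1, h2]

variable [MeasurableSpace Y] [DiscreteMeasurableSpace Y] [Finite Y]
  {ν : Measure Y} [IsProbabilityMeasure ν]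

local notation "𝐏" => Measure.infinitePi (fun _ : ℕ => ν)

theorem integral_one_add_sub_mul_onBlock {n l : ℕ} {B s : (ℕ → Y) → ℝ}
    (hB : DependsOn B (Set.Iio (l * n))) (hs : DependsOn s (Set.Iio n)) :
    ∫ ω, (1 + (B ω - B ω * onBlock n s ω l)) ∂𝐏 = 1 + (1 - ∫ ω, s ω ∂𝐏) * ∫ ω, B ω ∂𝐏 := by
  have hBs : DependsOn (fun ω => B ω * onBlock n s ω l) (Set.Iio ((l + 1) * n)) :=
    DependsOn.comp₂ (hB.mono (Set.Iio_subset_Iio (Nat.mul_le_mul_right n l.le_succ)))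
      (dependsOn_onBlock hs l) fun a b => a * b
  have h1 : ∫ ω, B ω * onBlock n s ω l ∂𝐏 = (∫ ω, B ω ∂𝐏) * ∫ ω, s ω ∂𝐏 :=
    integral_mul_shift hB hs
  have i1 : Integrable (fun ω => B ω - B ω * onBlock n s ω l) 𝐏 :=
    (integrable_of_dependsOn hB).sub (integrable_of_dependsOn hBs)
  rw [integral_add (integrable_const _) i1, integral_sub (integrable_of_dependsOn hB)
    (integrable_of_dependsOn hBs), h1]
  simp
  ring

theorem integral_runLength_succ {n : ℕ} {s : (ℕ → Y) → ℝ} (hs : DependsOn s (Set.Iio n)) (l : ℕ) :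
    ∫ ω, runLength (onBlock n s ω) (l + 1) ∂𝐏 =
      1 + (1 - ∫ ω, s ω ∂𝐏) * ∫ ω, runLength (onBlock n s ω) l ∂𝐏 := by
  rw [← integral_one_add_sub_mul_onBlock (dependsOn_runLength hs l) hs]
  congr 1 with ω
  rw [runLength]
  ring

theorem integral_runLength_sq_succ {n : ℕ} {s : (ℕ → Y) → ℝ} (hs : DependsOn s (Set.Iio n))
    (hs01 : ∀ ω, s ω = 0 ∨ s ω = 1) (l : ℕ) :
    ∫ ω, runLength (onBlock n s ω) (l + 1) ^ 2 ∂𝐏 =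
      1 + (1 - ∫ ω, s ω ∂𝐏) * ∫ ω, (2 * runLength (onBlock n s ω) l +
        runLength (onBlock n s ω) l ^ 2) ∂𝐏 := by
  have hA := dependsOn_runLength hs l
  rw [← integral_one_add_sub_mul_onBlock (DependsOn.comp₂ hA hA fun a b => 2 * a + b ^ 2) hs]
  congr 1 with ω
  rw [runLength]
  rcases hs01 fun i => ω (l * n + i) with h | h <;> simp only [onBlock, h] <;> ring

/-- The first moments obey `x ↦ 1 + (1 - p) x`, with fixed point `1 / p`. With that bound inserted,
the recursion of the second moments maps `2 / p²` to `2 / p² - 1`, so `2 / p²` is preserved as an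
upper bound. -/
theorem integral_runLength_sq_le {n : ℕ} {s : (ℕ → Y) → ℝ} (hs : DependsOn s (Set.Iio n))
    (hs01 : ∀ ω, s ω = 0 ∨ s ω = 1) (hp : 0 < ∫ ω, s ω ∂𝐏) (l : ℕ) :
    ∫ ω, runLength (onBlock n s ω) l ^ 2 ∂𝐏 ≤ 2 / (∫ ω, s ω ∂𝐏) ^ 2 := by
  set p := ∫ ω, s ω ∂𝐏 with hpdef
  have hp1 : p ≤ 1 := by
    have : p ≤ ∫ _, (1 : ℝ) ∂𝐏 := integral_mono (integrable_of_dependsOn hs)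
      (integrable_const _) fun ω => by rcases hs01 ω with h | h <;> simp [h]
    simpa using this
  have h1 : ∀ l, ∫ ω, runLength (onBlock n s ω) l ∂𝐏 ≤ 1 / p := by
    intro l
    induction l with
    | zero =>
      simp only [runLength, integral_const, probReal_univ, smul_eq_mul, mul_one]
      exact (one_le_div hp).2 hp1
    | succ l ih =>
      rw [integral_runLength_succ hs, ← hpdef]
      have := mul_le_mul_of_nonneg_left ih (sub_nonneg.2 hp1)
      have h2 : 1 + (1 - p) * (1 / p) = 1 / p := by field_simp; ring
      linarith
  induction l with
  | zero =>
    simp only [runLength, integral_const, probReal_univ, smul_eq_mul, mul_one, one_pow]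
    rw [le_div_iff₀ (by positivity)]
    nlinarith
  | succ l ih =>
    rw [integral_runLength_sq_succ hs hs01, ← hpdef]
    have hA := dependsOn_runLength hs l
    have hA2 : DependsOn (fun ω => runLength (onBlock n s ω) l ^ 2) (Set.Iio (l * n)) :=
      DependsOn.comp₂ hA hA fun a _ => a ^ 2
    rw [integral_add ((integrable_of_dependsOn hA).const_mul 2) (integrable_of_dependsOn hA2),
      integral_const_mul]
    have := mul_le_mul_of_nonneg_left (add_le_add (mul_le_mul_of_nonneg_left (h1 l) zero_le_two) ih)
      (sub_nonneg.2 hp1)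
    have h2 : 1 + (1 - p) * (2 * (1 / p) + 2 / p ^ 2) = 2 / p ^ 2 - 1 := by field_simp; ring
    linarith

/-- The sum is a martingale: the centred `h` on a new block is independent of the past, so cross
terms vanish and the second moment grows at most linearly. -/
theorem integral_sq_sum_runLength_mul_le {n : ℕ} {s h : (ℕ → Y) → ℝ}
    (hs : DependsOn s (Set.Iio n)) (hs01 : ∀ ω, s ω = 0 ∨ s ω = 1) (hp : 0 < ∫ ω, s ω ∂𝐏)
    (hh : DependsOn h (Set.Iio n)) (hh0 : ∫ ω, h ω ∂𝐏 = 0) (N : ℕ) :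
    ∫ ω, (∑ l ∈ Finset.range N, runLength (onBlock n s ω) l * onBlock n h ω l) ^ 2 ∂𝐏 ≤
      N * (2 / (∫ ω, s ω ∂𝐏) ^ 2 * ∫ ω, h ω ^ 2 ∂𝐏) := by
  induction N with
  | zero => simp
  | succ N ih =>
    set S : (ℕ → Y) → ℝ :=
      fun ω => ∑ l ∈ Finset.range N, runLength (onBlock n s ω) l * onBlock n h ω l with hS
    have hS1 : DependsOn S (Set.Iio (N * n)) := dependsOn_sum_runLength_mul hs hh N
    have hA := dependsOn_runLength hs N
    have hSA : DependsOn (fun ω => 2 * S ω * runLength (onBlock n s ω) N) (Set.Iio (N * n)) :=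
      DependsOn.comp₂ hS1 hA fun a b => 2 * a * b
    have hA2 : DependsOn (fun ω => runLength (onBlock n s ω) N ^ 2) (Set.Iio (N * n)) :=
      DependsOn.comp₂ hA hA fun a _ => a ^ 2
    have hh2 : DependsOn (fun ω => h ω ^ 2) (Set.Iio n) := DependsOn.comp₂ hh hh fun a _ => a ^ 2
    have hS2 : DependsOn (fun ω => S ω ^ 2) (Set.Iio (N * n)) :=
      DependsOn.comp₂ hS1 hS1 fun a _ => a ^ 2
    have hsub := Set.Iio_subset_Iio (Nat.mul_le_mul_right n N.le_succ)
    have e1 : ∫ ω, 2 * S ω * runLength (onBlock n s ω) N * onBlock n h ω N ∂𝐏 = 0 := by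
      have := integral_mul_shift (ν := ν) hSA hh
      rw [hh0, mul_zero] at this
      exact this
    have e2 : ∫ ω, runLength (onBlock n s ω) N ^ 2 * onBlock n h ω N ^ 2 ∂𝐏 =
        (∫ ω, runLength (onBlock n s ω) N ^ 2 ∂𝐏) * ∫ ω, h ω ^ 2 ∂𝐏 :=
      integral_mul_shift (ν := ν) hA2 hh2
    have i1 : Integrable (fun ω => 2 * S ω * runLength (onBlock n s ω) N * onBlock n h ω N) 𝐏 :=
      integrable_of_dependsOn (DependsOn.comp₂ (hSA.mono hsub) (dependsOn_onBlock hh N)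
        fun a b => a * b)
    have i2 : Integrable (fun ω => runLength (onBlock n s ω) N ^ 2 * onBlock n h ω N ^ 2) 𝐏 :=
      integrable_of_dependsOn (DependsOn.comp₂ (hA2.mono hsub) (dependsOn_onBlock hh N)
        fun a b => a * b ^ 2)
    have e3 : ∀ ω, (∑ l ∈ Finset.range (N + 1),
        runLength (onBlock n s ω) l * onBlock n h ω l) ^ 2 =
        S ω ^ 2 + (2 * S ω * runLength (onBlock n s ω) N * onBlock n h ω N +
          runLength (onBlock n s ω) N ^ 2 * onBlock n h ω N ^ 2) := by
      intro ω
      rw [Finset.sum_range_succ]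
      simp only [hS]
      ring
    simp_rw [e3]
    have i3 : Integrable (fun ω => 2 * S ω * runLength (onBlock n s ω) N * onBlock n h ω N +
        runLength (onBlock n s ω) N ^ 2 * onBlock n h ω N ^ 2) 𝐏 := i1.add i2
    rw [integral_add (integrable_of_dependsOn hS2) i3, integral_add i1 i2, e1, e2]
    have := mul_le_mul_of_nonneg_right (integral_runLength_sq_le hs hs01 hp N)
      (integral_nonneg (μ := 𝐏) fun ω => sq_nonneg (h ω))
    push_cast
    linarith

theorem ae_tendsto_sum_runLength_mul_div {n : ℕ} {s c : (ℕ → Y) → ℝ}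
    (hs : DependsOn s (Set.Iio n)) (hs01 : ∀ ω, s ω = 0 ∨ s ω = 1) (hp : 0 < ∫ ω, s ω ∂𝐏)
    (hc : DependsOn c (Set.Iio n)) (hc0 : ∀ ω, 0 ≤ c ω) :
    ∀ᵐ ω ∂𝐏, Tendsto (fun N : ℕ => (∑ l ∈ Finset.range N,
      runLength (onBlock n s ω) l * onBlock n c ω l) / N) atTop
      (𝓝 ((∫ ω, c ω ∂𝐏) / ∫ ω, s ω ∂𝐏)) := by
  set p := ∫ ω, s ω ∂𝐏 with hpdef
  set μ := ∫ ω, c ω ∂𝐏 with hμdef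
  -- Subtracting a multiple of `s`, not a constant, centres `c`: the sum of `runLength * s` is known
  -- exactly, whereas that of `runLength` alone is not.
  set h : (ℕ → Y) → ℝ := fun ω => p * c ω - μ * s ω with hh
  have hhd : DependsOn h (Set.Iio n) := DependsOn.comp₂ hc hs fun a b => p * a - μ * b
  have hh0 : ∫ ω, h ω ∂𝐏 = 0 := by
    simp only [hh]
    rw [integral_sub ((integrable_of_dependsOn hc).const_mul _)
      ((integrable_of_dependsOn hs).const_mul _), integral_const_mul, integral_const_mul]
    ring
  set S : ℕ → (ℕ → Y) → ℝ := fun N ω =>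
    ∑ l ∈ Finset.range N, runLength (onBlock n s ω) l * onBlock n h ω l with hS
  have hSd : ∀ N, DependsOn (S N) (Set.Iio (N * n)) :=
    fun N => dependsOn_sum_runLength_mul hs hhd N
  -- `Z` also absorbs the boundary term of `sum_runLength_mul`, so that `p` times the sum in
  -- question is exactly `Z N + μ * (N + 1)`.
  set Z : ℕ → (ℕ → Y) → ℝ := fun N ω => S N ω - μ * runLength (onBlock n s ω) N with hZ
  have hZd : ∀ N, DependsOn (Z N) (Set.Iio (N * n)) :=
    fun N => DependsOn.comp₂ (hSd N) (dependsOn_runLength hs N) fun a b => a - μ * b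
  set K := 2 / p ^ 2 * ∫ ω, h ω ^ 2 ∂𝐏 with hK
  have hK0 : 0 ≤ K := mul_nonneg (by positivity) (integral_nonneg fun ω => sq_nonneg _)
  have hZb : ∀ N, ∫ ω, Z N ω ^ 2 ∂𝐏 ≤ 2 * (N * K) + 2 * μ ^ 2 * (2 / p ^ 2) := by
    intro N
    have hA := dependsOn_runLength hs N
    have i1 : Integrable (fun ω => S N ω ^ 2) 𝐏 :=
      integrable_of_dependsOn (DependsOn.comp₂ (hSd N) (hSd N) fun a _ => a ^ 2)
    have i2 : Integrable (fun ω => runLength (onBlock n s ω) N ^ 2) 𝐏 :=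
      integrable_of_dependsOn (DependsOn.comp₂ hA hA fun a _ => a ^ 2)
    have i3 : Integrable (fun ω => Z N ω ^ 2) 𝐏 :=
      integrable_of_dependsOn (DependsOn.comp₂ (hZd N) (hZd N) fun a _ => a ^ 2)
    calc ∫ ω, Z N ω ^ 2 ∂𝐏
        ≤ ∫ ω, (2 * S N ω ^ 2 + 2 * μ ^ 2 * runLength (onBlock n s ω) N ^ 2) ∂𝐏 := by
          refine integral_mono i3 ((i1.const_mul 2).add (i2.const_mul (2 * μ ^ 2))) fun ω => ?_
          simp only [hZ]
          nlinarith [sq_nonneg (S N ω + μ * runLength (onBlock n s ω) N)]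
      _ = 2 * ∫ ω, S N ω ^ 2 ∂𝐏 + 2 * μ ^ 2 * ∫ ω, runLength (onBlock n s ω) N ^ 2 ∂𝐏 := by
          rw [integral_add (i1.const_mul 2) (i2.const_mul (2 * μ ^ 2)), integral_const_mul,
            integral_const_mul]
      _ ≤ _ := by
          have := integral_sq_sum_runLength_mul_le hs hs01 hp hhd hh0 N
          have := integral_runLength_sq_le hs hs01 hp N
          gcongr
  -- A second moment of order `N` is summable after division by `N²` only along a subsequence such
  -- as the squares.
  have hlim : ∀ᵐ ω ∂𝐏, Tendsto (fun m : ℕ => (Z (m ^ 2) ω / (m : ℝ) ^ 2) ^ 2) atTop (𝓝 0) := by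
    set K' := 2 * K + 2 * μ ^ 2 * (2 / p ^ 2) with hK'
    refine ae_tendsto_zero_of_integral_le (b := fun m : ℕ => K' * (1 / (m : ℝ) ^ 2))
      (fun m ω => sq_nonneg _) (fun m => ?_) (fun m => ?_)
      ((Real.summable_one_div_nat_pow.2 one_lt_two).mul_left _)
    · exact integrable_of_dependsOn (DependsOn.comp₂ (hZd (m ^ 2)) (hZd (m ^ 2))
        fun a _ => (a / (m : ℝ) ^ 2) ^ 2)
    · rcases Nat.eq_zero_or_pos m with rfl | hm
      · simp
      have hm' : (1 : ℝ) ≤ (m : ℝ) ^ 2 := one_le_pow₀ (by exact_mod_cast hm)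
      have := hZb (m ^ 2)
      simp_rw [div_pow]
      rw [integral_div, div_le_iff₀ (by positivity)]
      refine this.trans ?_
      have e : K' * (1 / (m : ℝ) ^ 2) * ((m : ℝ) ^ 2) ^ 2 = K' * (m : ℝ) ^ 2 := by
        field_simp
      rw [e, hK']
      push_cast
      have : 2 * μ ^ 2 * (2 / p ^ 2) * 1 ≤ 2 * μ ^ 2 * (2 / p ^ 2) * (m : ℝ) ^ 2 := by gcongr
      linarith
  filter_upwards [hlim] with ω hω
  have hω' : Tendsto (fun m : ℕ => Z (m ^ 2) ω / (m : ℝ) ^ 2) atTop (𝓝 0) := by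
    have := hω.sqrt
    simp only [Real.sqrt_sq_eq_abs, Real.sqrt_zero] at this
    exact (tendsto_zero_iff_abs_tendsto_zero _).2 this
  have hA0 : ∀ l, 0 ≤ runLength (onBlock n s ω) l := runLength_nonneg fun l => by
    rcases hs01 fun i => ω (l * n + i) with h | h <;> simp [onBlock, h]
  refine tendsto_div_of_tendsto_sq_div ?_ ?_
  · refine monotone_nat_of_le_succ fun N => ?_
    rw [Finset.sum_range_succ]
    exact le_add_of_nonneg_right (mul_nonneg (hA0 N) (hc0 _))
  · have key : ∀ N : ℕ, ∑ l ∈ Finset.range N, runLength (onBlock n s ω) l * onBlock n c ω l =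
        (Z N ω + μ * (N + 1)) / p := by
      intro N
      rw [eq_div_iff hp.ne']
      have h1 := sum_runLength_mul (onBlock n s ω) N
      have h2 : S N ω = p * (∑ l ∈ Finset.range N,
          runLength (onBlock n s ω) l * onBlock n c ω l) -
          μ * ∑ l ∈ Finset.range N, runLength (onBlock n s ω) l * onBlock n s ω l := by
        simp only [hS, hh, onBlock, Finset.mul_sum, ← Finset.sum_sub_distrib]
        exact Finset.sum_congr rfl fun l _ => by ring
      simp only [hZ, h2, h1]
      ring
    have h1 : Tendsto (fun m : ℕ => (1 : ℝ) / (m : ℝ) ^ 2) atTop (𝓝 0) := by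
      simpa using (tendsto_one_div_atTop_nhds_zero_nat (𝕜 := ℝ)).pow 2
    have h2 : Tendsto (fun m : ℕ => (Z (m ^ 2) ω / (m : ℝ) ^ 2 + μ * (1 + 1 / (m : ℝ) ^ 2)) / p)
        atTop (𝓝 (μ / p)) := by
      simpa using (hω'.add ((h1.const_add 1).const_mul μ)).div_const p
    refine h2.congr' ?_
    filter_upwards [eventually_gt_atTop 0] with m hm
    have hm0 : (m : ℝ) ≠ 0 := by exact_mod_cast hm.ne'
    rw [key]
    push_cast
    field_simp

end StrongLaw

/-! ### Time averages of ages -/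

section TimeAverage

variable {f : ℕ → ℤ}

theorem intervalIntegrable_age (hf : Monotone f) (a b : ℝ) :
    IntervalIntegrable (fun t : ℝ => t - (f (⌊t⌋₊ + 1) : ℝ)) volume a b := by
  refine intervalIntegral.intervalIntegrable_id.sub (Monotone.intervalIntegrable fun x y hxy => ?_)
  exact_mod_cast hf (Nat.add_le_add_right (Nat.floor_le_floor hxy) 1)

theorem integral_age_nat (hf : Monotone f) (N : ℕ) :
    ∫ t in (0 : ℝ)..N, (t - (f (⌊t⌋₊ + 1) : ℝ)) =
      (N : ℝ) ^ 2 / 2 - ∑ i ∈ Finset.range N, (f (i + 1) : ℝ) := by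
  induction N with
  | zero => simp
  | succ N ih =>
    rw [← intervalIntegral.integral_add_adjacent_intervals
      (intervalIntegrable_age hf 0 N) (intervalIntegrable_age hf N _), ih, Finset.sum_range_succ]
    have h : ∫ t in (N : ℝ)..((N + 1 : ℕ) : ℝ), (t - (f (⌊t⌋₊ + 1) : ℝ)) =
        ∫ t in (N : ℝ)..((N + 1 : ℕ) : ℝ), (t - (f (N + 1) : ℝ)) := by
      refine intervalIntegral.integral_congr_ae ?_
      -- The floor jumps at the right endpoint, which is a null set.
      have : ∀ᵐ t : ℝ, t ≠ ((N + 1 : ℕ) : ℝ) := by simp [ae_iff]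
      filter_upwards [this] with t ht htm
      rw [Set.uIoc_of_le (by simp)] at htm
      have : ⌊t⌋₊ = N := by
        rw [Nat.floor_eq_iff ((Nat.cast_nonneg N).trans htm.1.le)]
        exact ⟨htm.1.le, by simpa using lt_of_le_of_ne htm.2 ht⟩
      rw [this]
    rw [h, intervalIntegral.integral_sub intervalIntegral.intervalIntegrable_id
      intervalIntegrable_const]
    simp
    ring

/-- For a nonnegative integrand, the integral up to `τ` lies between those up to the neighbouring
multiples of `n`, and both multiples are asymptotic to `τ`. -/
theorem tendsto_average_of_tendsto_multiples {g : ℝ → ℝ} (hg : ∀ t, 0 ≤ t → 0 ≤ g t)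
    (hi : ∀ a b, IntervalIntegrable g volume a b) {n : ℕ} (hn : 0 < n) {D : ℝ}
    (h : Tendsto (fun N : ℕ => (∫ t in (0 : ℝ)..((N * n : ℕ) : ℝ), g t) / N) atTop (𝓝 (n * D))) :
    Tendsto (fun τ : ℝ => 1 / τ * ∫ t in (0 : ℝ)..τ, g t) atTop (𝓝 D) := by
  have hn' : (0 : ℝ) < n := by exact_mod_cast hn
  have hmono : ∀ a b : ℝ, 0 ≤ a → a ≤ b → ∫ t in (0 : ℝ)..a, g t ≤ ∫ t in (0 : ℝ)..b, g t := by
    intro a b ha hab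
    rw [← intervalIntegral.integral_add_adjacent_intervals (hi 0 a) (hi a b)]
    exact le_add_of_nonneg_right (intervalIntegral.integral_nonneg hab fun u hu =>
      hg u (ha.trans hu.1))
  set N : ℝ → ℕ := fun τ => ⌊(1 / n : ℝ) * τ⌋₊ with hN
  have hNt : Tendsto N atTop atTop :=
    tendsto_nat_floor_atTop.comp (tendsto_id.const_mul_atTop (by positivity))
  have h1 : Tendsto (fun τ => (N τ : ℝ) / τ) atTop (𝓝 (1 / n)) :=
    tendsto_nat_floor_mul_div_atTop (by positivity)
  have h2 : Tendsto (fun τ => ((N τ + 1 : ℕ) : ℝ) / τ) atTop (𝓝 (1 / n)) := by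
    have := h1.add (tendsto_const_nhds.div_atTop tendsto_id : Tendsto (fun τ : ℝ => 1 / τ) atTop (𝓝 0))
    rw [add_zero] at this
    refine this.congr fun τ => ?_
    push_cast
    rw [add_div]
  have e : (n * D) * (1 / n) = D := by field_simp
  have h3 := (h.comp hNt).mul h1
  have h4 := ((h.comp (tendsto_add_atTop_nat 1)).comp hNt).mul h2
  rw [e] at h3 h4
  refine tendsto_of_tendsto_of_tendsto_of_le_of_le' h3 h4 ?_ ?_
  · filter_upwards [eventually_gt_atTop 0, hNt.eventually_gt_atTop 0] with τ hτ hτN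
    have hN0 : (N τ : ℝ) ≠ 0 := by exact_mod_cast hτN.ne'
    have hle : ((N τ * n : ℕ) : ℝ) ≤ τ := by
      have := Nat.floor_le (a := (1 / n : ℝ) * τ) (by positivity)
      push_cast
      calc (N τ : ℝ) * n ≤ (1 / n * τ) * n := by gcongr
        _ = τ := by field_simp
    have := hmono _ _ (Nat.cast_nonneg _) hle
    simp only [Function.comp]
    rw [div_mul_div_comm, mul_comm _ (N τ : ℝ), mul_div_mul_left _ _ hN0, div_eq_mul_one_div,
      mul_comm]
    gcongr
  · filter_upwards [eventually_gt_atTop 0] with τ hτ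
    have hN0 : ((N τ + 1 : ℕ) : ℝ) ≠ 0 := by positivity
    have hle : τ ≤ (((N τ + 1) * n : ℕ) : ℝ) := by
      have := (Nat.lt_floor_add_one ((1 / n : ℝ) * τ)).le
      push_cast
      calc τ = (1 / n * τ) * n := by field_simp
        _ ≤ (N τ + 1 : ℝ) * n := by gcongr
    have := hmono _ _ hτ.le hle
    simp only [Function.comp]
    rw [div_mul_div_comm, mul_comm _ ((N τ + 1 : ℕ) : ℝ), mul_div_mul_left _ _ hN0,
      div_eq_mul_one_div (∫ t in (0 : ℝ)..(((N τ + 1) * n : ℕ) : ℝ), g t), mul_comm (∫ t in _.._, _)]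
    gcongr

end TimeAverage

/-! ### Freshest message of a decoder that decodes the current block at given times -/

section Freshest

open Classical in
/-- Generation time of the freshest message decoded during the channel uses `0, …, N - 1` if
`good i` tells whether the message of the current block has been decoded at channel use `i`. -/
noncomputable def freshestOf (n : ℕ) (good : ℕ → Prop) : ℕ → ℤ
  | 0 => -(n : ℤ)
  | N + 1 => if good N then max (freshestOf n good N) ((N / n * n : ℕ) : ℤ) else freshestOf n good N

variable {n : ℕ} {good : ℕ → Prop}

theorem monotone_freshestOf : Monotone (freshestOf n good) := by
  refine monotone_nat_of_le_succ fun N => ?_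
  rw [freshestOf]
  split_ifs
  · exact le_max_left _ _
  · exact le_rfl

theorem freshestOf_succ_le (N : ℕ) : freshestOf n good (N + 1) ≤ N := by
  have h : ∀ N : ℕ, ((N / n * n : ℕ) : ℤ) ≤ N := fun N => by exact_mod_cast Nat.div_mul_le_self N n
  induction N with
  | zero =>
    rw [freshestOf, freshestOf]
    split_ifs
    · exact max_le (by simp) (h 0)
    · simp
  | succ N ih =>
    rw [freshestOf]
    split_ifs
    · exact max_le (by push_cast; linarith) (h _)
    · push_cast; linarith

theorem freshestOf_le (N : ℕ) : freshestOf n good N ≤ N := by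
  cases N with
  | zero => simp [freshestOf]
  | succ N =>
    have := freshestOf_succ_le (n := n) (good := good) N
    push_cast
    linarith

theorem le_freshestOf {i N : ℕ} (hi : good i) (hN : i < N) :
    ((i / n * n : ℕ) : ℤ) ≤ freshestOf n good N := by
  refine le_trans ?_ (monotone_freshestOf hN)
  rw [freshestOf, if_pos hi]
  exact le_max_right _ _

open Classical in
-- Everything decoded before block `l` is at most `l * n` old in generation index, so the maximum in
-- the recursion is decided by the current block alone.
theorem freshestOf_block (hmono : ∀ l m m', m ≤ m' → m' < n → good (l * n + m) →
    good (l * n + m')) (l : ℕ) {m : ℕ} (hm : m < n) :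
    freshestOf n good (l * n + m + 1) =
      if good (l * n + m) then ((l * n : ℕ) : ℤ) else freshestOf n good (l * n) := by
  have hdiv : ∀ m < n, (l * n + m) / n * n = l * n := by
    intro m hm
    rw [mul_comm l n, Nat.mul_add_div (by lia), Nat.div_eq_of_lt hm, add_zero, mul_comm]
  induction m with
  | zero =>
    have h0 := hdiv 0 hm
    rw [add_zero] at h0
    rw [add_zero, freshestOf, h0, max_eq_right (freshestOf_le _)]
  | succ m ih =>
    have ih := ih (by lia)
    rw [freshestOf, hdiv _ hm, ← add_assoc, ih]
    by_cases h1 : good (l * n + m)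
    · have h2 := hmono l m (m + 1) (by lia) hm h1
      rw [if_pos h1, if_pos (by simpa [add_assoc] using h2)]
      simp
      exact fun h => absurd (by simpa [add_assoc] using h2) h
    · rw [if_neg h1, max_eq_right (freshestOf_le _)]

open Classical in
theorem freshestOf_mul (hn : 0 < n) (hmono : ∀ l m m', m ≤ m' → m' < n → good (l * n + m) →
    good (l * n + m')) (l : ℕ) :
    (freshestOf n good (l * n) : ℝ) =
      (l - runLength (fun l => if good (l * n + (n - 1)) then 1 else 0) l) * n := by
  induction l with
  -- The initial values agree: `-n = (0 - 1) * n`, since round `-1` counts as a success.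
  | zero => simp [freshestOf, runLength]
  | succ l ih =>
    have h1 : (l + 1) * n = l * n + (n - 1) + 1 := by rw [Nat.succ_mul]; lia
    rw [h1, freshestOf_block hmono l (by lia), runLength]
    split_ifs
    · push_cast; ring
    · rw [ih]; push_cast; ring

open Classical in
-- By `integral_age_nat`, the left side is the integrated age over `N` blocks. Each block
-- contributes `n² / 2`, plus `n` times its run length for every channel use at which its message is
-- still unknown.
theorem sum_freshestOf (hn : 0 < n) (hmono : ∀ l m m', m ≤ m' → m' < n → good (l * n + m) →
    good (l * n + m')) (N : ℕ) :
    ((N * n : ℕ) : ℝ) ^ 2 / 2 - ∑ i ∈ Finset.range (N * n), (freshestOf n good (i + 1) : ℝ) =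
      N * (n : ℝ) ^ 2 / 2 + n * ∑ l ∈ Finset.range N,
        runLength (fun l => if good (l * n + (n - 1)) then 1 else 0) l *
          ∑ m ∈ Finset.range n, if good (l * n + m) then (0 : ℝ) else 1 := by
  induction N with
  | zero => simp
  | succ N ih =>
    set A := runLength (fun l => if good (l * n + (n - 1)) then 1 else 0) N with hA
    have h1 : ∑ m ∈ Finset.range n, (freshestOf n good (N * n + m + 1) : ℝ) =
        n * (N * n) - n * (A * ∑ m ∈ Finset.range n, if good (N * n + m) then (0 : ℝ) else 1) := by
      have h2 : ∀ m ∈ Finset.range n, (freshestOf n good (N * n + m + 1) : ℝ) =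
          N * n - n * A * if good (N * n + m) then (0 : ℝ) else 1 := by
        intro m hm
        rw [freshestOf_block hmono N (Finset.mem_range.1 hm)]
        split_ifs
        · push_cast; ring
        · rw [freshestOf_mul hn hmono, ← hA]; ring
      rw [Finset.sum_congr rfl h2, Finset.sum_sub_distrib, Finset.sum_const, Finset.card_range,
        nsmul_eq_mul, ← Finset.mul_sum]
      ring
    rw [Nat.succ_mul, Finset.sum_range_add, Finset.sum_range_succ, ← hA, h1]
    push_cast at ih ⊢
    linarith

open Classical in
theorem tendsto_average_freshestOf (hn : 0 < n) (hmono : ∀ l m m', m ≤ m' → m' < n →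
    good (l * n + m) → good (l * n + m')) {L : ℝ}
    (h : Tendsto (fun N : ℕ => (∑ l ∈ Finset.range N,
        runLength (fun l => if good (l * n + (n - 1)) then 1 else 0) l *
          ∑ m ∈ Finset.range n, if good (l * n + m) then (0 : ℝ) else 1) / N) atTop (𝓝 L)) :
    Tendsto (fun τ : ℝ => 1 / τ * ∫ t in (0 : ℝ)..τ, (t - (freshestOf n good (⌊t⌋₊ + 1) : ℝ)))
      atTop (𝓝 (n / 2 + L)) := by
  refine tendsto_average_of_tendsto_multiples (fun t ht => ?_)
    (intervalIntegrable_age monotone_freshestOf) hn ?_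
  · have h1 : (freshestOf n good (⌊t⌋₊ + 1) : ℝ) ≤ ⌊t⌋₊ := by exact_mod_cast freshestOf_succ_le _
    linarith [Nat.floor_le ht]
  · have h1 : Tendsto (fun N : ℕ => (n : ℝ) * (n / 2 + (∑ l ∈ Finset.range N,
        runLength (fun l => if good (l * n + (n - 1)) then 1 else 0) l *
          ∑ m ∈ Finset.range n, if good (l * n + m) then (0 : ℝ) else 1) / N)) atTop
        (𝓝 (n * (n / 2 + L))) := (h.const_add _).const_mul _
    refine h1.congr' ?_
    filter_upwards [eventually_gt_atTop 0] with N hN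
    have hN0 : (N : ℝ) ≠ 0 := by exact_mod_cast hN.ne'
    rw [integral_age_nat monotone_freshestOf, sum_freshestOf hn hmono]
    field_simp

end Freshest

/-! ### Decoding tests evaluated on i.i.d. blocks -/

section BlockTest

variable {Y : Type*}

/-- Evaluate, at channel use `i`, the test `G (m + 1)` on the current block, where `m` is the
position of `i` in its block. -/
def blockTest (n : ℕ) (G : ℕ → (ℕ → Y) → Prop) (ω : ℕ → Y) (i : ℕ) : Prop :=
  G (i % n + 1) fun j => ω (i / n * n + j)

theorem blockTest_mul_add {n : ℕ} {G : ℕ → (ℕ → Y) → Prop} {ω : ℕ → Y} {l m : ℕ} (hm : m < n) :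
    blockTest n G ω (l * n + m) ↔ G (m + 1) fun j => ω (l * n + j) := by
  have h1 : (l * n + m) / n = l := by
    rw [mul_comm l n, Nat.mul_add_div (by lia), Nat.div_eq_of_lt hm, add_zero]
  have h2 : (l * n + m) % n = m := by
    rw [mul_comm l n, Nat.mul_add_mod, Nat.mod_eq_of_lt hm]
  rw [blockTest, h1, h2]

theorem dependsOn_ite {G : (ℕ → Y) → Prop} [DecidablePred G] {S : Set ℕ} (hG : DependsOn G S)
    (a b : ℝ) : DependsOn (fun ω => if G ω then a else b) S := by
  intro x y hxy
  have h := hG hxy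
  simp only [h]

variable [MeasurableSpace Y] [DiscreteMeasurableSpace Y] [Finite Y] {ν : Measure Y}

open Classical in
theorem measurableSet_of_dependsOn {G : (ℕ → Y) → Prop} {m : ℕ} (hG : DependsOn G (Set.Iio m)) :
    MeasurableSet {ω | G ω} := by
  have h := measurable_of_dependsOn (dependsOn_ite hG 1 0)
  have h2 : {ω | G ω} = (fun ω => if G ω then (1 : ℝ) else 0) ⁻¹' {1} := by
    ext ω
    simp
  rw [h2]
  exact h (measurableSet_singleton 1)

theorem integral_ite_eq_measureReal {G : (ℕ → Y) → Prop} [DecidablePred G] {m : ℕ}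
    (hG : DependsOn G (Set.Iio m)) :
    ∫ ω, (if G ω then (1 : ℝ) else 0) ∂(Measure.infinitePi fun _ : ℕ => ν) =
      (Measure.infinitePi fun _ : ℕ => ν).real {ω | G ω} := by
  rw [← integral_indicator_one (measurableSet_of_dependsOn hG)]
  congr 1 with ω
  simp [Set.indicator_apply]

/-- The strong law is applied with `s` the success of a block and `c` its number of undecoded
positions. The mean of `c` is the sum of the failure probabilities after `1, …, n` symbols. -/
theorem ae_tendsto_average_blockTest [IsProbabilityMeasure ν] {n : ℕ} (hn : 0 < n) {G : ℕ → (ℕ → Y) → Prop}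
    (hG : ∀ m, DependsOn (G m) (Set.Iio m)) (hGm : ∀ m ω, G m ω → G (m + 1) ω)
    (hpos : 0 < (Measure.infinitePi fun _ : ℕ => ν).real {ω | G n ω}) :
    ∀ᵐ ω ∂(Measure.infinitePi fun _ : ℕ => ν),
      Tendsto (fun τ : ℝ => 1 / τ *
        ∫ t in (0 : ℝ)..τ, (t - (freshestOf n (blockTest n G ω) (⌊t⌋₊ + 1) : ℝ))) atTop
      (𝓝 (n / 2 + (∑ m ∈ Finset.range n,
        (1 - (Measure.infinitePi fun _ : ℕ => ν).real {ω | G (m + 1) ω})) /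
          (Measure.infinitePi fun _ : ℕ => ν).real {ω | G n ω})) := by
  classical
  set s : (ℕ → Y) → ℝ := fun ω => if G n ω then 1 else 0 with hs
  set c : (ℕ → Y) → ℝ := fun ω => ∑ m ∈ Finset.range n, if G (m + 1) ω then 0 else 1 with hc
  have hGle : ∀ ω m m', m ≤ m' → G m ω → G m' ω := fun ω m m' h hm =>
    Nat.le_induction hm (fun k _ => hGm k ω) m' h
  have hcm : ∀ m ∈ Finset.range n, DependsOn (G (m + 1)) (Set.Iio n) := fun m hm =>
    (hG (m + 1)).mono (Set.Iio_subset_Iio (by simpa using hm))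
  have hcd : DependsOn c (Set.Iio n) := fun x y hxy => Finset.sum_congr rfl fun m hm =>
    dependsOn_ite (hcm m hm) 0 1 hxy
  have hsi : ∫ ω, s ω ∂(Measure.infinitePi fun _ : ℕ => ν) =
      (Measure.infinitePi fun _ : ℕ => ν).real {ω | G n ω} := integral_ite_eq_measureReal (hG n)
  have hci : ∫ ω, c ω ∂(Measure.infinitePi fun _ : ℕ => ν) = ∑ m ∈ Finset.range n,
      (1 - (Measure.infinitePi fun _ : ℕ => ν).real {ω | G (m + 1) ω}) := by
    rw [integral_finsetSum _ fun m hm => integrable_of_dependsOn (dependsOn_ite (hcm m hm) 0 1)]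
    refine Finset.sum_congr rfl fun m hm => ?_
    rw [← integral_ite_eq_measureReal (hG (m + 1))]
    have h1 : ∀ ω, (if G (m + 1) ω then (0 : ℝ) else 1) = 1 - if G (m + 1) ω then 1 else 0 := by
      intro ω
      split_ifs <;> simp
    simp_rw [h1]
    rw [integral_sub (integrable_const _)
      (integrable_of_dependsOn (dependsOn_ite (hG (m + 1)) 1 0))]
    simp
  rw [← hsi, ← hci]
  filter_upwards [ae_tendsto_sum_runLength_mul_div (ν := ν) (dependsOn_ite (hG n) 1 0)
    (fun ω => by split_ifs <;> simp) (hsi ▸ hpos) hcd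
    (fun ω => Finset.sum_nonneg fun m _ => by split_ifs <;> simp)] with ω hω
  refine tendsto_average_freshestOf hn (fun l m m' h hm' => ?_) (hω.congr fun N => ?_)
  · rw [blockTest_mul_add (h.trans_lt hm'), blockTest_mul_add hm']
    exact hGle _ _ _ (by lia)
  · congr 1
    refine Finset.sum_congr rfl fun l _ => ?_
    congr 1
    · congr 1
      ext l
      simp only [onBlock]
      have h1 := blockTest_mul_add (G := G) (ω := ω) (l := l) (show n - 1 < n by lia)
      rw [Nat.sub_add_cancel hn] at h1
      simp [h1]
    · refine Finset.sum_congr rfl fun m hm => ?_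
      have h1 := blockTest_mul_add (G := G) (ω := ω) (l := l) (Finset.mem_range.1 hm)
      simp [h1]

end BlockTest

/-! ### Waiting times for `k` successes -/

/-- Probability that there are at least `k` successes in `m` Bernoulli trials with success
probability `p`, that is, that the waiting time for `k` successes is at most `m`. -/
noncomputable def waitCdf (p : ℝ) : ℕ → ℕ → ℝ
  | 0, _ => 1
  | _ + 1, 0 => 0
  | k + 1, m + 1 => p * waitCdf p k m + (1 - p) * waitCdf p (k + 1) m

section WaitCdf

variable {p : ℝ}

@[simp]
theorem waitCdf_zero (m : ℕ) : waitCdf p 0 m = 1 := by simp [waitCdf]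

@[simp]
theorem waitCdf_succ_zero (k : ℕ) : waitCdf p (k + 1) 0 = 0 := by simp [waitCdf]

theorem waitCdf_succ_succ (k m : ℕ) :
    waitCdf p (k + 1) (m + 1) = p * waitCdf p k m + (1 - p) * waitCdf p (k + 1) m := by
  rw [waitCdf]

theorem waitCdf_nonneg (hp : 0 ≤ p) (hp1 : p ≤ 1) (k m : ℕ) : 0 ≤ waitCdf p k m := by
  induction m generalizing k with
  | zero => cases k <;> simp
  | succ m ih =>
    cases k with
    | zero => simp
    | succ k =>
      rw [waitCdf_succ_succ]
      exact add_nonneg (mul_nonneg hp (ih k)) (mul_nonneg (sub_nonneg.2 hp1) (ih _))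

theorem waitCdf_pos (hp : 0 < p) (hp1 : p ≤ 1) {k m : ℕ} (h : k ≤ m) : 0 < waitCdf p k m := by
  induction m generalizing k with
  | zero => simp [Nat.le_zero.1 h]
  | succ m ih =>
    cases k with
    | zero => simp
    | succ k =>
      rw [waitCdf_succ_succ]
      exact add_pos_of_pos_of_nonneg (mul_pos hp (ih (by lia)))
        (mul_nonneg (sub_nonneg.2 hp1) (waitCdf_nonneg hp.le hp1 _ _))

theorem waitCdf_le_one (hp : 0 ≤ p) (hp1 : p ≤ 1) (k m : ℕ) : waitCdf p k m ≤ 1 := by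
  induction m generalizing k with
  | zero => cases k <;> simp
  | succ m ih =>
    cases k with
    | zero => simp
    | succ k =>
      rw [waitCdf_succ_succ]
      have h1 := mul_le_mul_of_nonneg_left (ih k) hp
      have h2 := mul_le_mul_of_nonneg_left (ih (k + 1)) (sub_nonneg.2 hp1)
      linarith

/-- The differences are binomial point probabilities, and the identity is `(j + 1) * (m + 1).choose
(j + 1) = (m + 1) * m.choose j`. -/
theorem succ_mul_waitCdf_sub (j m : ℕ) :
    ((j : ℝ) + 1) * (waitCdf p (j + 1) (m + 1) - waitCdf p (j + 2) (m + 1)) =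
      (m + 1) * p * (waitCdf p j m - waitCdf p (j + 1) m) := by
  induction m generalizing j with
  | zero =>
    cases j with
    | zero => simp [waitCdf_succ_succ]
    | succ j => simp [waitCdf_succ_succ]
  | succ m ih =>
    have h1 := ih j
    have e1 := waitCdf_succ_succ (p := p) j (m + 1)
    have e2 := waitCdf_succ_succ (p := p) (j + 1) (m + 1)
    cases j with
    | zero =>
      have e3 := waitCdf_succ_succ (p := p) 0 m
      simp only [waitCdf_zero, zero_add, Nat.cast_zero] at *
      push_cast
      linear_combination e1 - e2 + (1 - p) * h1 + (m + 1) * p * e3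
    | succ i =>
      have h2 := ih i
      have e3 := waitCdf_succ_succ (p := p) i m
      have e4 := waitCdf_succ_succ (p := p) (i + 1) m
      push_cast at *
      linear_combination ((i : ℝ) + 2) * (e1 - e2) + (1 - p) * h1 + p * h2 -
        (m + 1) * p * (e3 - e4)

/-- With `B` the waiting time for `k` successes, the left side is the mean of the positive part of
`n + 1 - B`. The last term is the mean of `B` on `B ≤ n`, because `b * P(B = b) = (k / p) * P(B' = b
+ 1)` for the waiting time `B'` of `k + 1` successes. -/
theorem sum_waitCdf (hp : p ≠ 0) {k : ℕ} (hk : 1 ≤ k) (n : ℕ) :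
    ∑ m ∈ Finset.range n, waitCdf p k (m + 1) =
      (n + 1) * waitCdf p k n - k * waitCdf p (k + 1) (n + 1) / p := by
  obtain ⟨j, rfl⟩ := Nat.exists_eq_add_of_le' hk
  induction n with
  | zero => simp [waitCdf_succ_succ]
  | succ n ih =>
    have h1 := succ_mul_waitCdf_sub (p := p) j n
    have e1 := waitCdf_succ_succ (p := p) (j + 1) (n + 1)
    have e2 := waitCdf_succ_succ (p := p) j n
    rw [Finset.sum_range_succ, ih]
    field_simp
    push_cast
    linear_combination (j + 1) * e1 + p * h1 - (n + 1) * p * e2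

end WaitCdf

/-! ### Distribution function of a sum of geometric variables -/

theorem geometricSum_zero_real_Iic (p : unitInterval) (m : ℕ) :
    (geometricSum 0 p).real (Set.Iic m) = 1 := by
  rw [geometricSum, map_measureReal_apply .of_discrete measurableSet_Iic]
  simp

/-- Condition on the first summand `a + 1`; only `a < m` leaves room for the others. -/
theorem geometricSum_succ_Iic (k : ℕ) (p : unitInterval) (m : ℕ) :
    geometricSum (k + 1) p (Set.Iic m) = ∑ a ∈ Finset.range m,
      geometricMeasure p {a} * geometricSum k p (Set.Iic (m - 1 - a)) := by
  have hmeas : ∀ k, Measurable fun L : Fin k → ℕ => ∑ i, (L i + 1) := fun k => by fun_prop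
  have h1 := (measurePreserving_piFinSuccAbove
    (fun _ : Fin (k + 1) => geometricMeasure p) 0).symm.map_eq
  have hm : MeasurableSet {z : ℕ × (Fin k → ℕ) | z.1 + 1 + ∑ i, (z.2 i + 1) ≤ m} :=
    measurableSet_le (by fun_prop) measurable_const
  rw [geometricSum, ← h1, Measure.map_map (hmeas _) (MeasurableEquiv.measurable _),
    Measure.map_apply ((hmeas _).comp (MeasurableEquiv.measurable _)) measurableSet_Iic]
  have h2 : ((fun L : Fin (k + 1) → ℕ => ∑ i, (L i + 1)) ∘
      (MeasurableEquiv.piFinSuccAbove (fun _ : Fin (k + 1) => ℕ) 0).symm) ⁻¹' Set.Iic m =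
      {z : ℕ × (Fin k → ℕ) | z.1 + 1 + ∑ i, (z.2 i + 1) ≤ m} := by
    ext z
    simp [Fin.sum_univ_succ, Fin.insertNthEquiv]
  rw [h2, Measure.prod_apply hm, lintegral_countable', tsum_eq_sum (s := Finset.range m)]
  · refine Finset.sum_congr rfl fun a ha => ?_
    rw [mul_comm, geometricSum, Measure.map_apply (hmeas k) measurableSet_Iic]
    congr 2
    ext L
    simp at ha ⊢
    lia
  · intro a ha
    have : Prod.mk a ⁻¹' {z : ℕ × (Fin k → ℕ) | z.1 + 1 + ∑ i, (z.2 i + 1) ≤ m} = ∅ := by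
      ext L
      simp at ha ⊢
      lia
    rw [this, measure_empty, zero_mul]

theorem geometricSum_real_Iic {p : unitInterval} (hp : p ≠ 0) (k m : ℕ) :
    (geometricSum k p).real (Set.Iic m) = waitCdf p k m := by
  have hprob : ∀ k, IsProbabilityMeasure (geometricSum k p) := fun k => by
    unfold geometricSum
    exact Measure.isProbabilityMeasure_map (Measurable.aemeasurable (by fun_prop))
  induction k generalizing m with
  | zero => simp [geometricSum_zero_real_Iic]
  | succ k ih =>
    have h1 : ∀ m, (geometricSum (k + 1) p).real (Set.Iic m) = ∑ a ∈ Finset.range m,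
        (1 - p : ℝ) ^ a * p * waitCdf p k (m - 1 - a) := by
      intro m
      rw [measureReal_def, geometricSum_succ_Iic, ENNReal.toReal_sum]
      · refine Finset.sum_congr rfl fun a _ => ?_
        rw [ENNReal.toReal_mul, ← measureReal_def, ← measureReal_def, ih,
          geometricMeasure_real_singleton hp]
      · exact fun a _ => ENNReal.mul_ne_top (measure_ne_top _ _) (measure_ne_top _ _)
    induction m with
    | zero => simp [h1]
    | succ m ihm =>
      -- The term `a = 0` is a success in the first trial; the remaining terms carry a factor `1 -
      -- p` for a first failure and form the sum for `m`.
      rw [waitCdf_succ_succ, ← ihm, h1, h1, Finset.sum_range_succ', add_comm, Finset.mul_sum]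
      congr 1
      · simp
      · refine Finset.sum_congr rfl fun a _ => ?_
        rw [show m + 1 - 1 - (a + 1) = m - 1 - a by lia]
        ring

/-- Average age of a scheme that decodes a block of `n` symbols within its first `m` channel uses
with probability `R m`. -/
noncomputable def ageOfCdf (n : ℕ) (R : ℕ → ℝ) : ℝ :=
  n / 2 + (∑ m ∈ Finset.range n, (1 - R (m + 1))) / R n

theorem ageLowerBound_eq {ε : unitInterval} (hε : (ε : ℝ) < 1) {n k : ℕ} (hk : 1 ≤ k)
    (hkn : k ≤ n) : ageLowerBound ε n k = ageOfCdf n (waitCdf (1 - ε) k) := by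
  have hp : (0 : ℝ) < 1 - ε := sub_pos.2 hε
  have hp0 : unitInterval.symm ε ≠ 0 := fun h => hp.ne' (by
    simpa using congrArg (Subtype.val) h)
  have ha : 0 < waitCdf (1 - (ε : ℝ)) k n := waitCdf_pos hp (by linarith [ε.2.1]) hkn
  rw [ageLowerBound, geometricSum_real_Iic hp0, geometricSum_real_Iic hp0, ageOfCdf,
    Finset.sum_sub_distrib, unitInterval.coe_symm_eq, sum_waitCdf hp.ne' hk]
  simp only [Finset.sum_const, Finset.card_range, nsmul_eq_mul, mul_one]
  field_simp
  ring

/-! ### Number of successes in an i.i.d. sequence -/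

section Counting

variable {Y : Type*}

/-- At least `k` of the first `m` terms of a sequence satisfy `r`. -/
def AtLeast (r : Y → Bool) (k m : ℕ) (ω : ℕ → Y) : Prop :=
  k ≤ ((Finset.range m).filter fun j => r (ω j) = true).card

theorem dependsOn_atLeast (r : Y → Bool) (k m : ℕ) : DependsOn (AtLeast r k m) (Set.Iio m) := by
  intro x y hxy
  rw [AtLeast, AtLeast]
  congr! 2
  refine Finset.filter_congr fun j hj => ?_
  rw [hxy j (by simpa using hj)]

theorem atLeast_succ {r : Y → Bool} {k m : ℕ} {ω : ℕ → Y} :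
    AtLeast r (k + 1) (m + 1) ω ↔ AtLeast r (k + 1) m ω ∨ (AtLeast r k m ω ∧ r (ω m) = true) := by
  rw [AtLeast, AtLeast, AtLeast, Finset.range_add_one, Finset.filter_insert]
  split_ifs with h
  · rw [Finset.card_insert_of_notMem (by simp)]
    simp only [h]
    lia
  · simp [h]

theorem atLeast_of_succ {r : Y → Bool} {k m : ℕ} {ω : ℕ → Y} (h : AtLeast r (k + 1) m ω) :
    AtLeast r k m ω := (Nat.le_succ k).trans h

theorem atLeast_succ_right {r : Y → Bool} {k m : ℕ} {ω : ℕ → Y} (h : AtLeast r k m ω) :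
    AtLeast r k (m + 1) ω :=
  le_trans h (Finset.card_le_card (Finset.filter_subset_filter _
    (Finset.range_subset_range.2 m.le_succ)))

variable [MeasurableSpace Y] [DiscreteMeasurableSpace Y] [Finite Y]
  {ν : Measure Y} [IsProbabilityMeasure ν]

theorem measureReal_atLeast {r : Y → Bool} (k m : ℕ) :
    (Measure.infinitePi fun _ : ℕ => ν).real {ω | AtLeast r k m ω} =
      waitCdf (ν.real {y | r y = true}) k m := by
  classical
  induction m generalizing k with
  | zero => cases k <;> simp [AtLeast]
  | succ m ih =>
    cases k with
    | zero => simp [AtLeast]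
    | succ k =>
      rw [waitCdf_succ_succ, ← ih, ← ih, ← integral_ite_eq_measureReal (dependsOn_atLeast r _ _),
        ← integral_ite_eq_measureReal (dependsOn_atLeast r _ _),
        ← integral_ite_eq_measureReal (dependsOn_atLeast r _ _)]
      have d1 := dependsOn_ite (dependsOn_atLeast r (k + 1) m) 1 0
      have d2 := dependsOn_ite (dependsOn_atLeast r k m) 1 0
      have d3 : DependsOn (fun ω : ℕ → Y => r (ω 0) = true) (Set.Iio 1) := by
        intro x y hxy
        simp only
        rw [hxy 0 (by simp)]
      have d4 := DependsOn.comp₂ d2 d1 fun a b => a - b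
      -- Either `k + 1` successes are already there, or there are exactly `k` and the last trial
      -- succeeds. That trial is independent of the first `m`; the index `m + 0` matches the shifted
      -- form of `integral_mul_shift`.
      have h1 : ∀ ω : ℕ → Y, (if AtLeast r (k + 1) (m + 1) ω then (1 : ℝ) else 0) =
          (if AtLeast r (k + 1) m ω then (1 : ℝ) else 0) +
          ((if AtLeast r k m ω then (1 : ℝ) else 0) -
            if AtLeast r (k + 1) m ω then (1 : ℝ) else 0) *
          if r (ω (m + 0)) = true then (1 : ℝ) else 0 := by
        intro ω
        rw [add_zero]
        have h2 := atLeast_succ (r := r) (k := k) (m := m) (ω := ω)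
        by_cases h3 : AtLeast r (k + 1) m ω
        · simp [h2, h3, atLeast_of_succ h3]
        · by_cases h4 : AtLeast r k m ω <;> by_cases h5 : r (ω m) = true <;> simp [h2, h3, h4, h5]
      have h6 : ∫ ω : ℕ → Y, (if r (ω 0) = true then (1 : ℝ) else 0)
          ∂(Measure.infinitePi fun _ : ℕ => ν) = ν.real {y | r y = true} := by
        rw [integral_ite_eq_measureReal d3]
        exact (measurePreserving_eval_infinitePi (fun _ : ℕ => ν) 0).measureReal_preimage
          (s := {y | r y = true}) (MeasurableSet.of_discrete).nullMeasurableSet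
      have h7 := integral_mul_shift (ν := ν) d4 (dependsOn_ite d3 1 0)
      have i1 := integrable_of_dependsOn (ν := ν) (DependsOn.comp₂
        (d4.mono (Set.Iio_subset_Iio m.le_succ)) (dependsOn_comp_shift_Iio
          (dependsOn_ite d3 1 0) m) fun a b => a * b)
      simp_rw [h1]
      rw [integral_add (integrable_of_dependsOn d1) i1, h7, h6, integral_sub
        (integrable_of_dependsOn d2) (integrable_of_dependsOn d1)]
      ring

end Counting

/-! ### Rank of the received columns of a random code -/

section Span

variable {F : Type*} [Field F] {k : ℕ}

/-- Span of the unerased columns among the first `m`; a pair consists of a column and its erasure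
indicator. -/
def receivedSpan (m : ℕ) (ω : ℕ → (Fin k → F) × Bool) : Submodule F (Fin k → F) :=
  Submodule.span F {v | ∃ j < m, (ω j).2 = false ∧ v = (ω j).1}

/-- The unerased columns among the first `m` determine the message. -/
def Decodable (m : ℕ) (ω : ℕ → (Fin k → F) × Bool) : Prop := receivedSpan m ω = ⊤

theorem dependsOn_receivedSpan (m : ℕ) :
    DependsOn (receivedSpan (F := F) (k := k) m) (Set.Iio m) := by
  intro x y hxy
  rw [receivedSpan, receivedSpan]
  congr 1
  ext v
  refine exists_congr fun j => and_congr_right fun hj => ?_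
  rw [hxy j hj]

theorem dependsOn_decodable (m : ℕ) : DependsOn (Decodable (F := F) (k := k) m) (Set.Iio m) := by
  intro x y hxy
  rw [Decodable, Decodable, dependsOn_receivedSpan m hxy]

theorem receivedSpan_mono {m m' : ℕ} (h : m ≤ m') (ω : ℕ → (Fin k → F) × Bool) :
    receivedSpan m ω ≤ receivedSpan m' ω :=
  Submodule.span_mono fun _ ⟨j, hj, hv⟩ => ⟨j, hj.trans_le h, hv⟩

theorem Decodable.mono {m m' : ℕ} (h : m ≤ m') {ω : ℕ → (Fin k → F) × Bool}
    (hω : Decodable m ω) : Decodable m' ω :=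
  eq_top_iff.2 (hω ▸ receivedSpan_mono h ω)

/-- A column and its erasure indicator: has the symbol been received? -/
def received (y : (Fin k → F) × Bool) : Bool := !y.2

theorem Decodable.atLeast {m : ℕ} {ω : ℕ → (Fin k → F) × Bool} (h : Decodable m ω) :
    AtLeast received k m ω := by
  classical
  set s := (Finset.range m).filter fun j => received (ω j) = true with hs
  have h1 : receivedSpan m ω = Submodule.span F ((s.image fun j => (ω j).1 : Finset _) : Set _) := by
    rw [receivedSpan]
    congr 1
    ext v
    simp only [hs, received, Finset.coe_image, Finset.coe_filter, Finset.mem_range, Set.mem_image,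
      Set.mem_ofPred_eq, Bool.not_eq_true', and_assoc]
    exact exists_congr fun j => and_congr_right fun _ => and_congr_right fun _ => eq_comm
  have h2 := finrank_span_finset_le_card (R := F) (s.image fun j => (ω j).1)
  rw [Set.finrank, ← h1, h, finrank_top, Module.finrank_fin_fun] at h2
  exact h2.trans Finset.card_image_le

/-- Each received column outside the span of the earlier ones raises the dimension by at least one.
-/
theorem decodable_or_card_le_finrank {m : ℕ} {ω : ℕ → (Fin k → F) × Bool}
    (h : ∀ j < m, Decodable j ω ∨ (ω j).1 ∉ receivedSpan j ω) :
    Decodable m ω ∨ ((Finset.range m).filter fun j => received (ω j) = true).card ≤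
      Module.finrank F (receivedSpan m ω) := by
  induction m with
  | zero => simp
  | succ m ih =>
    rcases ih fun j hj => h j (hj.trans m.lt_succ_self) with h1 | h1
    · exact Or.inl (h1.mono m.le_succ)
    rcases h m m.lt_succ_self with h2 | h2
    · exact Or.inl (h2.mono m.le_succ)
    right
    rw [Finset.range_add_one, Finset.filter_insert]
    split_ifs with h3
    · rw [Finset.card_insert_of_notMem (by simp)]
      refine (Nat.succ_le_succ h1).trans (Submodule.finrank_lt_finrank_of_lt ?_)
      refine lt_of_le_of_ne (receivedSpan_mono m.le_succ ω) fun h4 => h2 ?_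
      rw [h4]
      exact Submodule.subset_span ⟨m, m.lt_succ_self, by simpa [received] using h3, rfl⟩
    · exact h1.trans (Submodule.finrank_mono (receivedSpan_mono m.le_succ ω))

theorem exists_mem_receivedSpan {m : ℕ} {ω : ℕ → (Fin k → F) × Bool}
    (h1 : AtLeast received k m ω) (h2 : ¬ Decodable m ω) :
    ∃ j < m, ¬ Decodable j ω ∧ (ω j).1 ∈ receivedSpan j ω := by
  by_contra! h
  rcases decodable_or_card_le_finrank fun j hj => or_iff_not_imp_left.2 (h j hj) with h3 | h3
  · exact h2 h3
  · refine h2 (Submodule.eq_top_of_finrank_eq (le_antisymm (Submodule.finrank_le _) ?_))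
    rw [Module.finrank_fin_fun]
    exact le_trans h1 h3

end Span

/-! ### Decoding probability of the random code -/

section RandomColumns

variable (F : Type*) [Field F] [Fintype F] [MeasurableSpace F] [DiscreteMeasurableSpace F] (k : ℕ)

/-- Law of a single column of the random code. -/
noncomputable def columnLaw : Measure (Fin k → F) := uniformOn {v | v ≠ 0}

/-- Joint law of a column of the random code and the erasure indicator of its symbol. -/
noncomputable def symbolLaw (ε : unitInterval) : Measure ((Fin k → F) × Bool) :=
  (columnLaw F k).prod (bernoulliMeasure true false ε)

variable {k} in
theorem isProbabilityMeasure_columnLaw (hk : 1 ≤ k) : IsProbabilityMeasure (columnLaw F k) := by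
  refine isProbabilityMeasure_uniformOn (Set.toFinite _) ⟨fun _ => 1, fun h => ?_⟩
  exact one_ne_zero (congrFun h ⟨0, hk⟩)

variable {F k}

theorem columnLaw_real_le {V : Submodule F (Fin k → F)} (hV : V ≠ ⊤) :
    (columnLaw F k).real (V : Set (Fin k → F)) ≤ 1 / Fintype.card F := by
  classical
  set q := Fintype.card F with hq
  have hq0 : 0 < q := Fintype.card_pos
  set s : Finset (Fin k → F) := Finset.univ.erase 0 with hs
  set t : Finset (Fin k → F) := Finset.univ.filter (· ∈ V) with ht
  have h1 : columnLaw F k (V : Set (Fin k → F)) = (s ∩ t).card / s.card := by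
    have e1 : {v : Fin k → F | v ≠ 0} = (s : Set (Fin k → F)) := by ext v; simp [hs]
    have e2 : (V : Set (Fin k → F)) = (t : Set (Fin k → F)) := by ext v; simp [ht]
    rw [columnLaw, e1, e2, uniformOn_apply_finset]
  have h2 : s ∩ t = t.erase 0 := by
    ext v; simp [hs, ht]
  have h3 : (s ∩ t).card = t.card - 1 := by
    rw [h2, Finset.card_erase_of_mem (by simp [ht])]
  have h4 : s.card = q ^ k - 1 := by
    rw [hs, Finset.card_erase_of_mem (Finset.mem_univ _)]
    simp [hq]
  have h5 : t.card = q ^ Module.finrank F V := by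
    rw [hq, ← Module.card_eq_pow_finrank (K := F) (V := V), ht]
    exact (Fintype.card_subtype (· ∈ V)).symm
  have h6 : Module.finrank F V + 1 ≤ k := by
    have := Submodule.finrank_lt hV
    rwa [Module.finrank_fin_fun] at this
  -- A proper subspace of dimension `d ≤ k - 1` has `q ^ d - 1` nonzero vectors, and `q * (q ^ d -
  -- 1) ≤ q ^ k - 1`.
  have h7 : q * (s ∩ t).card ≤ s.card := by
    rw [h3, h4, h5, Nat.mul_sub, ← pow_succ']
    have := Nat.pow_le_pow_right hq0 h6
    lia
  rw [measureReal_def, h1, ENNReal.toReal_div, ENNReal.toReal_natCast, ENNReal.toReal_natCast]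
  rcases Nat.eq_zero_or_pos s.card with h0 | h0
  · rw [h0, Nat.cast_zero, div_zero]
    positivity
  · rw [div_le_div_iff₀ (by exact_mod_cast h0) (by exact_mod_cast hq0)]
    rw [one_mul, mul_comm]
    exact_mod_cast h7

theorem columnLaw_singleton_ne_zero {v : Fin k → F} (hv : v ≠ 0) : columnLaw F k {v} ≠ 0 := by
  rw [columnLaw, Ne, uniformOn_eq_zero_iff (Set.toFinite _)]
  exact (Set.Nonempty.ne_empty ⟨v, hv, rfl⟩)

variable {ε : unitInterval}

theorem symbolLaw_received (hk : 1 ≤ k) :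
    (symbolLaw F k ε).real {y | received y = true} = 1 - ε := by
  have := isProbabilityMeasure_columnLaw F hk
  have h : {y : (Fin k → F) × Bool | received y = true} = Set.univ ×ˢ {false} := by
    ext y
    simp [received]
  rw [symbolLaw, h, measureReal_prod_prod]
  simp

/-- Column `j` is independent of the span of the earlier received columns, so one may condition on
that span, which takes finitely many values. -/
theorem measureReal_dependent_column_le (hk : 1 ≤ k) (j : ℕ) :
    (Measure.infinitePi fun _ : ℕ => symbolLaw F k ε).real
      {ω | ¬ Decodable j ω ∧ (ω j).1 ∈ receivedSpan j ω} ≤ 1 / Fintype.card F := by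
  classical
  have := isProbabilityMeasure_columnLaw F hk
  have : IsProbabilityMeasure (symbolLaw F k ε) := by unfold symbolLaw; infer_instance
  have : Finite (Submodule F (Fin k → F)) :=
    Finite.of_injective (fun V => (V : Set (Fin k → F))) SetLike.coe_injective
  have := Fintype.ofFinite (Submodule F (Fin k → F))
  set P := Measure.infinitePi fun _ : ℕ => symbolLaw F k ε with hP
  have dV : ∀ V : Submodule F (Fin k → F), DependsOn
      (fun ω : ℕ → (Fin k → F) × Bool => receivedSpan j ω = V) (Set.Iio j) := by
    intro V x y hxy
    simp only [dependsOn_receivedSpan j hxy]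
  have dV' : ∀ V : Submodule F (Fin k → F), DependsOn
      (fun ω : ℕ → (Fin k → F) × Bool => receivedSpan j ω = V ∧ V ≠ ⊤) (Set.Iio j) := by
    intro V x y hxy
    simp only [dependsOn_receivedSpan j hxy]
  have d0 : ∀ V : Submodule F (Fin k → F), DependsOn
      (fun ω : ℕ → (Fin k → F) × Bool => (ω 0).1 ∈ V) (Set.Iio 1) := by
    intro V x y hxy
    simp only [hxy 0 (by simp)]
  have dB : DependsOn (fun ω : ℕ → (Fin k → F) × Bool =>
      ¬ Decodable j ω ∧ (ω j).1 ∈ receivedSpan j ω) (Set.Iio (j + 1)) := by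
    intro x y hxy
    simp only [Decodable, dependsOn_receivedSpan j fun i hi => hxy i (hi.trans j.lt_succ_self),
      hxy j (by simp)]
  rw [← integral_ite_eq_measureReal dB]
  have e1 : ∀ ω : ℕ → (Fin k → F) × Bool,
      (if ¬ Decodable j ω ∧ (ω j).1 ∈ receivedSpan j ω then (1 : ℝ) else 0) =
      ∑ V : Submodule F (Fin k → F), (if receivedSpan j ω = V ∧ V ≠ ⊤ then (1 : ℝ) else 0) *
        if (ω (j + 0)).1 ∈ V then (1 : ℝ) else 0 := by
    intro ω
    rw [Finset.sum_eq_single (receivedSpan j ω)]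
    · by_cases h : receivedSpan j ω = ⊤ <;> simp [Decodable, h]
    · intro V _ hV
      simp [hV.symm]
    · simp
  have e2 : ∀ V : Submodule F (Fin k → F), ∫ ω, (if (ω 0).1 ∈ V then (1 : ℝ) else 0) ∂P =
      (columnLaw F k).real (V : Set (Fin k → F)) := by
    intro V
    rw [integral_ite_eq_measureReal (d0 V)]
    have h1 := (measurePreserving_eval_infinitePi (fun _ : ℕ => symbolLaw F k ε) 0)
    have h2 : MeasurePreserving Prod.fst (symbolLaw F k ε) (columnLaw F k) :=
      measurePreserving_fst
    exact (h2.comp h1).measureReal_preimage (s := (V : Set (Fin k → F)))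
      (MeasurableSet.of_discrete).nullMeasurableSet
  have e3 : ∀ V : Submodule F (Fin k → F),
      ∫ ω, (if receivedSpan j ω = V ∧ V ≠ ⊤ then (1 : ℝ) else 0) *
        (if (ω (j + 0)).1 ∈ V then (1 : ℝ) else 0) ∂P ≤
      (∫ ω, (if receivedSpan j ω = V then (1 : ℝ) else 0) ∂P) * (1 / Fintype.card F) := by
    intro V
    have h1 := integral_mul_shift (ν := symbolLaw F k ε) (dependsOn_ite (dV' V) 1 0)
      (dependsOn_ite (d0 V) 1 0)
    rw [h1, e2]
    by_cases hV : V = ⊤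
    · simp only [hV, ne_eq, not_true_eq_false, and_false, if_false, integral_zero, zero_mul]
      refine mul_nonneg (integral_nonneg fun ω => ?_) (by positivity)
      simp only [Pi.zero_apply]
      split_ifs <;> simp
    · simp only [ne_eq, hV, not_false_eq_true, and_true]
      refine mul_le_mul_of_nonneg_left (columnLaw_real_le hV) (integral_nonneg fun ω => ?_)
      simp only [Pi.zero_apply]
      split_ifs <;> simp
  simp_rw [e1]
  rw [integral_finsetSum]
  · refine (Finset.sum_le_sum fun V _ => e3 V).trans ?_
    rw [← Finset.sum_mul, ← integral_finsetSum _ fun V _ =>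
      integrable_of_dependsOn (dependsOn_ite (dV V) 1 0)]
    simp
  · intro V _
    exact integrable_of_dependsOn (DependsOn.comp₂
      ((dependsOn_ite (dV' V) 1 0).mono (Set.Iio_subset_Iio j.le_succ))
      (dependsOn_comp_shift_Iio (dependsOn_ite (d0 V) 1 0) j) fun a b => a * b)

variable (F k ε) in
/-- Probability that the random code can be decoded after `m` channel uses of a block. -/
noncomputable def decodableProb (m : ℕ) : ℝ :=
  (Measure.infinitePi fun _ : ℕ => symbolLaw F k ε).real {ω | Decodable m ω}

theorem decodableProb_le (hk : 1 ≤ k) (m : ℕ) :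
    decodableProb F k ε m ≤ waitCdf (1 - ε) k m := by
  have := isProbabilityMeasure_columnLaw F hk
  have : IsProbabilityMeasure (symbolLaw F k ε) := by unfold symbolLaw; infer_instance
  rw [← symbolLaw_received (F := F) hk, ← measureReal_atLeast]
  exact measureReal_mono fun ω hω => hω.atLeast

/-- If `k` symbols arrive without decoding, one of the `m` columns fell into an earlier, still
proper span; a union bound over the columns finishes. -/
theorem waitCdf_le_decodableProb_add (hk : 1 ≤ k) (m : ℕ) :
    waitCdf (1 - ε) k m ≤ decodableProb F k ε m + m / Fintype.card F := by
  have := isProbabilityMeasure_columnLaw F hk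
  have : IsProbabilityMeasure (symbolLaw F k ε) := by unfold symbolLaw; infer_instance
  rw [← symbolLaw_received (F := F) hk, ← measureReal_atLeast]
  set B : ℕ → Set (ℕ → (Fin k → F) × Bool) :=
    fun j => {ω | ¬ Decodable j ω ∧ (ω j).1 ∈ receivedSpan j ω} with hB
  have h1 : {ω : ℕ → (Fin k → F) × Bool | AtLeast received k m ω} ⊆
      {ω | Decodable m ω} ∪ ⋃ j ∈ Finset.range m, B j := by
    intro ω hω
    by_cases h : Decodable m ω
    · exact Or.inl h
    · obtain ⟨j, hj, hj'⟩ := exists_mem_receivedSpan hω h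
      exact Or.inr (Set.mem_biUnion (Finset.mem_range.2 hj) hj')
  refine (measureReal_mono h1).trans ((measureReal_union_le _ _).trans ?_)
  refine add_le_add le_rfl ((measureReal_biUnion_finset_le _ _).trans ?_)
  refine (Finset.sum_le_sum fun j _ => measureReal_dependent_column_le hk j).trans ?_
  simp [div_eq_mul_inv]

theorem decodableProb_pos (hε : (ε : ℝ) < 1) (hk : 1 ≤ k) {n : ℕ} (hn : k ≤ n) :
    0 < decodableProb F k ε n := by
  classical
  have := isProbabilityMeasure_columnLaw F hk
  have : IsProbabilityMeasure (symbolLaw F k ε) := by unfold symbolLaw; infer_instance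
  -- The witness event has the standard basis as its first `k` columns, all unerased. The value
  -- beyond `k` only has to be nonzero.
  set w : ℕ → Fin k → F := fun j => if h : j < k then Pi.single ⟨j, h⟩ 1 else fun _ => 1 with hw
  have hw0 : ∀ j, w j ≠ 0 := by
    intro j h0
    simp only [hw] at h0
    split_ifs at h0 with h
    · simpa using congrFun h0 ⟨j, h⟩
    · exact one_ne_zero (congrFun h0 ⟨0, hk⟩)
  have h1 : Set.pi (Finset.range k : Set ℕ) (fun j => {((w j, false) : (Fin k → F) × Bool)}) ⊆
      {ω | Decodable n ω} := by
    intro ω hω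
    refine Decodable.mono hn (eq_top_iff.2 ?_)
    rw [← (Pi.basisFun F (Fin k)).span_eq]
    refine Submodule.span_mono ?_
    rintro _ ⟨i, rfl⟩
    have h2 : ω i = (w i, false) := hω i (by simp)
    refine ⟨i, i.2, by rw [h2], ?_⟩
    rw [h2]
    simp [hw]
  refine lt_of_lt_of_le ?_ (measureReal_mono h1)
  rw [measureReal_def, Measure.infinitePi_pi _ fun _ _ => measurableSet_singleton _]
  refine ENNReal.toReal_pos (Finset.prod_ne_zero_iff.2 fun j _ => ?_)
    (ENNReal.prod_ne_top fun j _ => measure_ne_top _ _)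
  rw [symbolLaw, ← Set.singleton_prod_singleton, Measure.prod_prod]
  refine mul_ne_zero (columnLaw_singleton_ne_zero (hw0 j)) ?_
  rw [bernoulliMeasure_apply_of_notMem_of_mem _ (measurableSet_singleton _) (by simp) (by simp)]
  have : unitInterval.toNNReal (unitInterval.symm ε) ≠ 0 := by
    intro h
    have := congrArg NNReal.toReal h
    simp at this
    linarith
  exact_mod_cast this

end RandomColumns

/-! ### Joint law of the random code and the erasures -/

/-- Code and erasures are drawn as two sequences, but the block tests need one i.i.d. sequence of
pairs. Equality is checked on singletons of finite projections. -/
theorem map_zip_infinitePi {X Z : Type*} [MeasurableSpace X] [MeasurableSpace Z]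
    [DiscreteMeasurableSpace X] [DiscreteMeasurableSpace Z] [Finite X] [Finite Z]
    (μ : Measure X) (ν : Measure Z) [IsProbabilityMeasure μ] [IsProbabilityMeasure ν] :
    ((Measure.infinitePi fun _ : ℕ => μ).prod (Measure.infinitePi fun _ : ℕ => ν)).map
      (fun p i => (p.1 i, p.2 i)) = Measure.infinitePi fun _ : ℕ => μ.prod ν := by
  have hz : Measurable (fun (p : (ℕ → X) × (ℕ → Z)) (i : ℕ) => (p.1 i, p.2 i)) := by fun_prop
  refine (Measure.isProjectiveLimit_infinitePi _).unique ?_ |>.symm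
  intro I
  refine Measure.ext_of_singleton fun a => ?_
  rw [Measure.map_map (by fun_prop) hz, Measure.map_apply (by fun_prop) (measurableSet_singleton a)]
  have h1 : (I.restrict ∘ fun (p : (ℕ → X) × (ℕ → Z)) (i : ℕ) => (p.1 i, p.2 i)) ⁻¹' {a} =
      (I.restrict (π := fun _ => X) ⁻¹' {fun i => (a i).1}) ×ˢ
        (I.restrict (π := fun _ => Z) ⁻¹' {fun i => (a i).2}) := by
    ext p
    simp [funext_iff, Prod.ext_iff, forall_and]
  rw [h1, Measure.prod_prod, ← Measure.map_apply (by fun_prop) (measurableSet_singleton _),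
    ← Measure.map_apply (by fun_prop) (measurableSet_singleton _),
    Measure.infinitePi_map_restrict, Measure.infinitePi_map_restrict, Measure.pi_singleton,
    Measure.pi_singleton, Measure.pi_singleton, ← Finset.prod_mul_distrib]
  refine Finset.prod_congr rfl fun i _ => ?_
  rw [← Measure.prod_prod, Set.singleton_prod_singleton]

/-! ### Decoding on the fly -/

section OnTheFly

variable {F : Type*} [Field F] {n k : ℕ}

theorem channelOutput_eq_some {S : Scheme F n k} {u : ℕ → Fin k → F} {e : ℕ → Bool} {i : ℕ} {z : F}
    (h : S.channelOutput u e i = some z) : u (i / n * n) ⬝ᵥ S.col i = z := by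
  rw [Scheme.channelOutput] at h
  split_ifs at h
  exact Option.some.inj h

theorem channelOutput_ne_none {S : Scheme F n k} {u : ℕ → Fin k → F} {e : ℕ → Bool} {i : ℕ} :
    S.channelOutput u e i ≠ none ↔ e i = false := by
  rw [Scheme.channelOutput]
  split_ifs with h <;> simp [h]

theorem div_eq_and_lt_iff (hn : 0 < n) {i m : ℕ} :
    (m < i + 1 ∧ m / n = i / n) ↔ ∃ j < i % n + 1, m = i / n * n + j := by
  constructor
  · rintro ⟨h1, h2⟩
    refine ⟨m % n, ?_, ?_⟩
    · have h3 := Nat.div_add_mod m n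
      have h4 := Nat.div_add_mod i n
      rw [h2] at h3
      lia
    · rw [← h2, Nat.div_add_mod']
  · rintro ⟨j, hj, rfl⟩
    have h4 := Nat.div_add_mod' i n
    have h5 := Nat.mod_lt i hn
    refine ⟨by lia, ?_⟩
    rw [mul_comm, Nat.mul_add_div hn, Nat.div_eq_of_lt (a := j) (by lia), add_zero]

theorem span_received_columns (hn : 0 < n) (g : ℕ → Fin k → F) (u : ℕ → Fin k → F) (e : ℕ → Bool)
    (i : ℕ) :
    Submodule.span F {v | ∃ m : Fin (i + 1), (m : ℕ) / n = i / n ∧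
        (onTheFly n g).channelOutput u e m ≠ none ∧ v = g m} =
      receivedSpan (i % n + 1) fun j => (g (i / n * n + j), e (i / n * n + j)) := by
  rw [receivedSpan]
  congr 1
  ext v
  simp only [channelOutput_ne_none]
  constructor
  · rintro ⟨m, hm, he, rfl⟩
    obtain ⟨j, hj, hmj⟩ := (div_eq_and_lt_iff hn).1 ⟨m.2, hm⟩
    rw [hmj] at he ⊢
    exact ⟨j, hj, he, rfl⟩
  · rintro ⟨j, hj, he, rfl⟩
    obtain ⟨h1, h2⟩ := (div_eq_and_lt_iff hn (i := i)).2 ⟨j, hj, rfl⟩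
    exact ⟨⟨_, h1⟩, h2, he, rfl⟩

open Classical in
-- The true message always solves the linear system, and when the received columns span, it is the
-- only solution.
theorem onTheFly_decoded (hn : 0 < n) (g : ℕ → Fin k → F) (u : ℕ → Fin k → F) (e : ℕ → Bool)
    (i : ℕ) : (onTheFly n g).decoded u e i =
      if blockTest n Decodable (fun j => (g j, e j)) i then some (i / n * n, u (i / n * n))
      else none := by
  have hs := span_received_columns hn g u e i
  have hex : ∃ w : Fin k → F, ∀ m : Fin (i + 1), (m : ℕ) / n = i / n →
      ∀ z : F, (onTheFly n g).channelOutput u e m = some z → w ⬝ᵥ g m = z := by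
    refine ⟨u (i / n * n), fun m hm z hz => ?_⟩
    have := channelOutput_eq_some hz
    rwa [hm] at this
  have hdef : (onTheFly n g).decoded u e i =
      if h : Submodule.span F {v | ∃ m : Fin (i + 1), (m : ℕ) / n = i / n ∧
        (onTheFly n g).channelOutput u e m ≠ none ∧ v = g m} = ⊤ ∧
        ∃ w : Fin k → F, ∀ m : Fin (i + 1), (m : ℕ) / n = i / n →
          ∀ z : F, (onTheFly n g).channelOutput u e m = some z → w ⬝ᵥ g m = z
      then some (i / n * n, h.2.choose) else none := rfl
  rw [hdef]
  by_cases h : blockTest n Decodable (fun j => (g j, e j)) i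
  · have h' : Submodule.span F {v | ∃ m : Fin (i + 1), (m : ℕ) / n = i / n ∧
        (onTheFly n g).channelOutput u e m ≠ none ∧ v = g m} = ⊤ := hs.trans h
    rw [if_pos h, dif_pos ⟨h', hex⟩]
    congr 2
    -- Both vectors have the same product with every received column, hence with every vector of
    -- their span.
    refine dotProduct_eq _ _ fun v => ?_
    have hv : v ∈ Submodule.span F {v | ∃ m : Fin (i + 1), (m : ℕ) / n = i / n ∧
        (onTheFly n g).channelOutput u e m ≠ none ∧ v = g m} := h' ▸ Submodule.mem_top
    have hw := hex.choose_spec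
    generalize hex.choose = w at hw
    induction hv using Submodule.span_induction with
    | mem v hv =>
      obtain ⟨m, hm, hne, rfl⟩ := hv
      obtain ⟨z, hz⟩ := Option.ne_none_iff_exists'.1 hne
      have := channelOutput_eq_some hz
      rw [hm] at this
      rw [hw m hm z hz]
      exact this.symm
    | zero => simp
    | add x y _ _ hx hy => rw [dotProduct_add, dotProduct_add, hx, hy]
    | smul a x _ hx => rw [dotProduct_smul, dotProduct_smul, hx]
  · rw [if_neg h, dif_neg fun h' => h (hs.symm.trans h'.1)]

theorem onTheFly_zeroError (hn : 0 < n) (g : ℕ → Fin k → F) : (onTheFly n g).ZeroError := by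
  classical
  intro u e i j w h
  rw [onTheFly_decoded hn] at h
  split_ifs at h
  simp only [Option.some.injEq, Prod.mk.injEq] at h
  rw [← h.1, h.2]

theorem onTheFly_freshest (hn : 0 < n) (g : ℕ → Fin k → F) (u : ℕ → Fin k → F) (e : ℕ → Bool)
    (N : ℕ) : (onTheFly n g).freshest u e N =
      freshestOf n (blockTest n Decodable fun j => (g j, e j)) N := by
  classical
  induction N with
  | zero => rfl
  | succ N ih =>
    rw [Scheme.freshest, freshestOf, onTheFly_decoded hn]
    by_cases h : blockTest n Decodable (fun j => (g j, e j)) N <;> simp [h, ih]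

end OnTheFly

/-! ### The average age of random codes -/

section AverageAge

variable {F : Type*} [Field F] [Fintype F] [MeasurableSpace F] [DiscreteMeasurableSpace F]
  {n k : ℕ} {ε : unitInterval}

instance : IsProbabilityMeasure (sourceLaw F k) := by
  have : ∀ _ : ℕ, IsProbabilityMeasure (uniformOn (Set.univ : Set (Fin k → F))) := fun _ =>
    isProbabilityMeasure_uniformOn (Set.toFinite _) Set.univ_nonempty
  unfold sourceLaw
  infer_instance

instance : IsProbabilityMeasure (erasureLaw ε) := by
  unfold erasureLaw
  infer_instance

theorem HasAverageAge.averageAge_eq {S : Scheme F n k} {D : ℝ} (h : HasAverageAge ε S D) :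
    averageAge ε S = D := by
  have hex : ∃ D, HasAverageAge ε S D := ⟨D, h⟩
  rw [averageAge, dif_pos hex]
  obtain ⟨p, hp1, hp2⟩ := (hex.choose_spec.and h).exists
  exact tendsto_nhds_unique hp1 hp2

theorem isProbabilityMeasure_randomCode (hk : 1 ≤ k) : IsProbabilityMeasure (randomCode F k) := by
  have : ∀ _ : ℕ, IsProbabilityMeasure (uniformOn {v : Fin k → F | v ≠ 0}) := fun _ =>
    isProbabilityMeasure_columnLaw F hk
  unfold randomCode
  infer_instance

theorem ae_hasAverageAge_onTheFly (hε : (ε : ℝ) < 1) (hk : 1 ≤ k) (hkn : k ≤ n) :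
    ∀ᵐ g ∂(randomCode F k),
      HasAverageAge ε (onTheFly n g) (ageOfCdf n (decodableProb F k ε)) := by
  have hn : 0 < n := hk.trans hkn
  have := isProbabilityMeasure_columnLaw F hk
  have : IsProbabilityMeasure (symbolLaw F k ε) := by unfold symbolLaw; infer_instance
  have := isProbabilityMeasure_randomCode (F := F) hk
  have h1 := ae_tendsto_average_blockTest (ν := symbolLaw F k ε) hn dependsOn_decodable
    (fun m ω h => h.mono m.le_succ) (decodableProb_pos hε hk hkn)
  have h2 : MeasurePreserving (fun (p : (ℕ → Fin k → F) × (ℕ → Bool)) (i : ℕ) => (p.1 i, p.2 i))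
      ((randomCode F k).prod (erasureLaw ε)) (Measure.infinitePi fun _ : ℕ => symbolLaw F k ε) :=
    ⟨by fun_prop, map_zip_infinitePi (columnLaw F k) (bernoulliMeasure true false ε)⟩
  -- Fubini turns an almost sure statement about code and erasures together into one for almost
  -- every fixed code; the source plays no role.
  have h3 := Measure.ae_ae_of_ae_prod (h2.quasiMeasurePreserving.ae h1)
  filter_upwards [h3] with g hg
  have h4 := (Measure.quasiMeasurePreserving_snd (μ := sourceLaw F k) (ν := erasureLaw ε)).ae hg
  filter_upwards [h4] with p hp
  simp only [Scheme.age, onTheFly_freshest hn]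
  exact hp

theorem randomCodeAge_eq (hε : (ε : ℝ) < 1) (hk : 1 ≤ k) (hkn : k ≤ n) :
    randomCodeAge ε F n k = ageOfCdf n (decodableProb F k ε) := by
  have := isProbabilityMeasure_randomCode (F := F) hk
  rw [randomCodeAge, integral_congr_ae (g := fun _ => ageOfCdf n (decodableProb F k ε))]
  · simp
  · filter_upwards [ae_hasAverageAge_onTheFly hε hk hkn] with g hg
    exact hg.averageAge_eq

theorem randomCodeAge_mem_achievedAges (hε : (ε : ℝ) < 1) (hk : 1 ≤ k) (hkn : k ≤ n) :
    randomCodeAge ε F n k ∈ achievedAges ε F k := by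
  have := isProbabilityMeasure_randomCode (F := F) hk
  obtain ⟨g, hg⟩ := (ae_hasAverageAge_onTheFly (F := F) hε hk hkn).exists
  rw [randomCodeAge_eq hε hk hkn]
  exact ⟨n, hkn, onTheFly n g, onTheFly_zeroError (hk.trans hkn) g, hg⟩

/-- `ageOfCdf n` is a function of the finitely many values of `R` up to `n`, continuous where the
denominator `R n` does not vanish. -/
theorem exists_forall_abs_ageOfCdf_sub_lt {n : ℕ} {R : ℕ → ℝ} (hR : R n ≠ 0) {δ : ℝ} (hδ : 0 < δ) :
    ∃ η > 0, ∀ R' : ℕ → ℝ, (∀ m ≤ n, |R' m - R m| < η) → |ageOfCdf n R' - ageOfCdf n R| < δ := by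
  set φ : (Fin n → ℝ) × ℝ → ℝ := fun x => n / 2 + (∑ m, (1 - x.1 m)) / x.2 with hφ
  have h1 : ∀ R : ℕ → ℝ, ageOfCdf n R = φ (fun m => R (m + 1), R n) := by
    intro R
    simp only [ageOfCdf, hφ]
    rw [← Fin.sum_univ_eq_sum_range fun m => 1 - R (m + 1)]
  have h2 : ContinuousAt φ (fun m => R (m + 1), R n) := by
    refine continuousAt_const.add (ContinuousAt.div ?_ continuousAt_snd hR)
    fun_prop
  obtain ⟨η, hη, h3⟩ := Metric.continuousAt_iff.1 h2 δ hδ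
  refine ⟨η, hη, fun R' hR' => ?_⟩
  rw [h1, h1]
  refine h3 ?_
  rw [Prod.dist_eq, max_lt_iff, dist_pi_lt_iff hη]
  exact ⟨fun m => hR' _ m.2, hR' n le_rfl⟩

theorem exists_forall_abs_randomCodeAge_sub_lt (hε : (ε : ℝ) < 1) (hk : 1 ≤ k) (hkn : k ≤ n) {δ : ℝ}
    (hδ : 0 < δ) : ∃ q₀ : ℕ, 0 < q₀ ∧
      ∀ (F : Type) [Field F] [Fintype F] [MeasurableSpace F] [DiscreteMeasurableSpace F],
        q₀ ≤ Fintype.card F → |randomCodeAge ε F n k - ageLowerBound ε n k| < δ := by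
  have hp : (0 : ℝ) < 1 - ε := sub_pos.2 hε
  obtain ⟨η, hη, h⟩ := exists_forall_abs_ageOfCdf_sub_lt
    (waitCdf_pos hp (by linarith [ε.2.1]) hkn).ne' hδ
  -- This makes the loss `m / q` in the decoding probability smaller than `η` for all `m ≤ n`.
  obtain ⟨q₀, hq₀⟩ := exists_nat_gt (n / η)
  refine ⟨q₀ + 1, Nat.succ_pos _, fun F _ _ _ _ hF => ?_⟩
  rw [randomCodeAge_eq hε hk hkn, ageLowerBound_eq hε hk hkn]
  refine h _ fun m hm => ?_
  have h1 := decodableProb_le (F := F) (ε := ε) hk m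
  have h2 := waitCdf_le_decodableProb_add (F := F) (ε := ε) hk m
  have hq : (q₀ : ℝ) < Fintype.card F := by exact_mod_cast hF
  have h3 : (m : ℝ) / Fintype.card F < η := by
    have hF0 : (0 : ℝ) < Fintype.card F := lt_of_le_of_lt (Nat.cast_nonneg _) hq
    rw [div_lt_iff₀ hF0]
    have h4 : (n : ℝ) < η * Fintype.card F := by
      rw [div_lt_iff₀ hη] at hq₀
      nlinarith
    exact lt_of_le_of_lt (by exact_mod_cast hm) h4
  rw [abs_lt]
  constructor <;> linarith

end AverageAge

/-! ### Lower bound for schemes without decoding errors -/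

section Converse

variable {F : Type*} [Field F] {n k : ℕ}

/-- With fewer than `k` unerased columns, some nonzero `d` is orthogonal to all of them. Adding `d`
to the symbol `j` leaves the channel outputs unchanged, so the decoder errs on one of the two
sources. A discarded symbol `j` is covered too: nothing sent depends on it. -/
theorem le_card_of_decoded {S : Scheme F n k} (hS : S.ZeroError) {u : ℕ → Fin k → F}
    {e : ℕ → Bool} {N j : ℕ} {w : Fin k → F} (h : S.decoded u e N = some (j, w)) :
    k ≤ ((Finset.range (N + 1)).filter fun m => m / n * n = j ∧ e m = false).card := by
  classical
  set s := (Finset.range (N + 1)).filter fun m => m / n * n = j ∧ e m = false with hs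
  by_contra! hlt
  set V := Submodule.span F ((s.image S.col : Finset _) : Set (Fin k → F)) with hV
  have h1 : V ≠ ⊤ := by
    intro h1
    have h2 := finrank_span_finset_le_card (R := F) (s.image S.col)
    rw [Set.finrank, ← hV, h1, finrank_top, Module.finrank_fin_fun] at h2
    exact absurd (h2.trans Finset.card_image_le) (not_le.2 hlt)
  obtain ⟨f, hf0, hf⟩ := Submodule.exists_le_ker_of_lt_top V (lt_top_iff_ne_top.2 h1)
  set d : Fin k → F := fun i => f (Pi.single i 1) with hd
  have hfd : ∀ v, d ⬝ᵥ v = f v := by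
    intro v
    conv_rhs => rw [LinearMap.pi_apply_eq_sum_univ f v]
    simp only [dotProduct, hd, smul_eq_mul]
    refine Finset.sum_congr rfl fun i _ => ?_
    rw [mul_comm]
    congr 2
    ext j
    simp [Pi.single_apply, eq_comm]
  have hd0 : d ≠ 0 := by
    intro h0
    refine hf0 (LinearMap.ext fun v => ?_)
    rw [← hfd, h0, zero_dotProduct, LinearMap.zero_apply]
  set u' := Function.update u j (u j + d) with hu'
  have h2 : ∀ m ≤ N, S.channelOutput u' e m = S.channelOutput u e m := by
    intro m hm
    rw [Scheme.channelOutput, Scheme.channelOutput]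
    split_ifs with he
    · rfl
    rw [Scheme.channelInput, Scheme.channelInput, hu']
    by_cases hj : m / n * n = j
    · have hm' : S.col m ∈ V := Submodule.subset_span (by
        simp only [Finset.coe_image]
        exact ⟨m, by simp [hs, hj, he]; lia, rfl⟩)
      have h3 : f (S.col m) = 0 := hf hm'
      rw [hj, Function.update_self, add_dotProduct, hfd, h3, add_zero]
    · rw [Function.update_of_ne hj]
  have h3 : S.decoded u' e N = some (j, w) := by
    rw [← h, Scheme.decoded, Scheme.decoded]
    congr 1
    ext1 m
    exact h2 m (Nat.lt_succ_iff.1 m.2)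
  have h4 := hS u e N j w h
  have h5 := hS u' e N j w h3
  rw [hu', Function.update_self, h4] at h5
  exact hd0 (by simpa using h5)

/-- The ideal decoder, which knows a block after `k` unerased symbols, is never behind a zero-error
scheme. -/
theorem freshest_le (hn : 0 < n) (hk : 1 ≤ k) {S : Scheme F n k} (hS : S.ZeroError)
    (u : ℕ → Fin k → F) (e : ℕ → Bool) (N : ℕ) :
    S.freshest u e N ≤ freshestOf n (blockTest n (AtLeast (!·) k) e) N := by
  classical
  induction N with
  | zero => exact le_rfl
  | succ N ih =>
    have hmono := monotone_freshestOf (n := n) (good := blockTest n (AtLeast (!·) k) e) N.le_succ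
    rw [Scheme.freshest]
    split
    · exact ih.trans hmono
    rename_i j w h
    refine max_le (ih.trans hmono) ?_
    have hcard := le_card_of_decoded hS h
    set s := (Finset.range (N + 1)).filter fun m => m / n * n = j ∧ e m = false with hs
    -- Decoding may come long after the block of `j` has ended. At the last unerased use `i` of that
    -- block up to `N`, the ideal decoder has already seen all the required symbols.
    obtain ⟨i, hi, hmax⟩ := s.exists_max_image id (Finset.card_pos.1 (hk.trans hcard))
    simp only [hs, Finset.mem_filter, Finset.mem_range] at hi
    rw [← hi.2.1]
    refine le_freshestOf ?_ hi.1
    refine hcard.trans ?_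
    have hsub : s ⊆ ((Finset.range (i % n + 1)).filter fun j => (!e (i / n * n + j)) = true).image
        fun j => i / n * n + j := by
      intro m hm
      have hmi : m ≤ i := hmax m hm
      simp only [hs, Finset.mem_filter, Finset.mem_range] at hm
      have hdiv : m / n = i / n := Nat.eq_of_mul_eq_mul_right hn (hm.2.1.trans hi.2.1.symm)
      obtain ⟨j', hj', hmj⟩ := (div_eq_and_lt_iff hn).1 ⟨Nat.lt_succ_of_le hmi, hdiv⟩
      have he := hm.2.2
      rw [hmj] at he ⊢
      exact Finset.mem_image_of_mem _ (by simp [he]; lia)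
    exact (Finset.card_le_card hsub).trans Finset.card_image_le

theorem monotone_freshest (S : Scheme F n k) (u : ℕ → Fin k → F) (e : ℕ → Bool) :
    Monotone (S.freshest u e) := by
  refine monotone_nat_of_le_succ fun N => ?_
  rw [Scheme.freshest]
  split
  · exact le_rfl
  · exact le_max_left _ _

variable [Fintype F] [MeasurableSpace F] [DiscreteMeasurableSpace F] {ε : unitInterval}

theorem ageLowerBound_le (hε : (ε : ℝ) < 1) (hk : 1 ≤ k) (hkn : k ≤ n) {S : Scheme F n k}
    (hS : S.ZeroError) {D : ℝ} (hD : HasAverageAge ε S D) : ageLowerBound ε n k ≤ D := by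
  have hn : 0 < n := hk.trans hkn
  have hp : (0 : ℝ) < 1 - ε := sub_pos.2 hε
  have hrec : (bernoulliMeasure true false ε).real {b : Bool | (!b) = true} = 1 - ε := by
    have : {b : Bool | (!b) = true} = {false} := by ext b; simp
    rw [this]
    simp
  have hprob : ∀ m, (Measure.infinitePi fun _ : ℕ => bernoulliMeasure true false ε).real
      {e | AtLeast (!·) k m e} = waitCdf (1 - ε) k m := fun m => by
    rw [measureReal_atLeast, hrec]
  have h1 := ae_tendsto_average_blockTest (ν := bernoulliMeasure true false ε) hn
    (dependsOn_atLeast (!·) k) (fun m e h => atLeast_succ_right h)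
    (by rw [hprob]; exact waitCdf_pos hp (by linarith [ε.2.1]) hkn)
  simp only [hprob] at h1
  have h2 := (Measure.quasiMeasurePreserving_snd (μ := sourceLaw F k) (ν := erasureLaw ε)).ae h1
  -- Both limits are constants, so a single sample point at which both hold suffices for comparing
  -- them.
  obtain ⟨p, hp1, hp2⟩ := (h2.and hD).exists
  rw [ageLowerBound_eq hε hk hkn, ageOfCdf]
  refine le_of_tendsto_of_tendsto hp1 hp2 ?_
  filter_upwards [eventually_gt_atTop 0] with τ hτ
  refine mul_le_mul_of_nonneg_left ?_ (by positivity)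
  refine intervalIntegral.integral_mono_on hτ.le
    (intervalIntegrable_age monotone_freshestOf _ _)
    (intervalIntegrable_age (monotone_freshest S p.1 p.2) _ _) fun t _ => ?_
  rw [Scheme.age]
  have := freshest_le hn hk hS p.1 p.2 (⌊t⌋₊ + 1)
  have : (S.freshest p.1 p.2 (⌊t⌋₊ + 1) : ℝ) ≤
    freshestOf n (blockTest n (AtLeast (!·) k) p.2) (⌊t⌋₊ + 1) := by exact_mod_cast this
  linarith

theorem div_two_le_ageLowerBound (hε : (ε : ℝ) < 1) (hk : 1 ≤ k) (hkn : k ≤ n) :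
    (n : ℝ) / 2 ≤ ageLowerBound ε n k := by
  have hp : (0 : ℝ) ≤ 1 - ε := sub_nonneg.2 hε.le
  have hp1 : (1 : ℝ) - ε ≤ 1 := by linarith [ε.2.1]
  rw [ageLowerBound_eq hε hk hkn, ageOfCdf]
  refine le_add_of_nonneg_right (div_nonneg (Finset.sum_nonneg fun m _ => ?_)
    (waitCdf_nonneg hp hp1 _ _))
  exact sub_nonneg.2 (waitCdf_le_one hp hp1 _ _)

end Converse

/-- A real sequence with `n / 2 ≤ f n` for `n ≥ k` attains its minimum over `n ≥ k`. -/
theorem exists_forall_ge_le {k : ℕ} {f : ℕ → ℝ} (hf : ∀ n, k ≤ n → (n : ℝ) / 2 ≤ f n) :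
    ∃ n, k ≤ n ∧ ∀ m, k ≤ m → f n ≤ f m := by
  -- Beyond `N` the growth bound already exceeds `f k`, so only a finite range competes.
  obtain ⟨N, hN⟩ := exists_nat_gt (2 * f k)
  obtain ⟨n, hn, hmin⟩ := (Finset.Icc k (k + N)).exists_min_image f ⟨k, by simp⟩
  rw [Finset.mem_Icc] at hn
  refine ⟨n, hn.1, fun m hm => ?_⟩
  rcases le_or_gt m (k + N) with h | h
  · exact hmin m (Finset.mem_Icc.2 ⟨hm, h⟩)
  · have h1 := hf m hm
    have h2 : (N : ℝ) ≤ m := by exact_mod_cast (Nat.le_add_left N k).trans h.le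
    have h3 := hmin k (by simp)
    linarith

end AgeErasure

/-! ### Assembly of the three statements -/

theorem theorem6 (ε : unitInterval) (hε : (ε : ℝ) < 1) (k : ℕ) (hk : 1 ≤ k) :
    -- The average age of the random code exists, and almost surely equals its expectation.
    (∀ (F : Type) [Field F] [Fintype F] [MeasurableSpace F] [DiscreteMeasurableSpace F] (n : ℕ),
      k ≤ n →
        ∀ᵐ g ∂(AgeErasure.randomCode F k),
          AgeErasure.HasAverageAge ε (AgeErasure.onTheFly n g)
            (AgeErasure.randomCodeAge ε F n k)) ∧
    -- For fixed `(n, k)` it is within `δ` of the lower bound for large alphabets.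
    (∀ n : ℕ, k ≤ n → ∀ δ : ℝ, 0 < δ → ∃ q₀ : ℕ, 0 < q₀ ∧
      ∀ (F : Type) [Field F] [Fintype F] [MeasurableSpace F] [DiscreteMeasurableSpace F],
        q₀ ≤ Fintype.card F →
          (∀ᵐ g ∂(AgeErasure.randomCode F k),
            |AgeErasure.averageAge ε (AgeErasure.onTheFly n g) -
              AgeErasure.ageLowerBound ε n k| < δ) ∧
          |AgeErasure.randomCodeAge ε F n k - AgeErasure.ageLowerBound ε n k| < δ) ∧
    -- The optimal average age and the minimum over `n ≥ k` of the random-code age differ by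
    -- less than `δ` for large alphabets.
    (∀ δ : ℝ, 0 < δ → ∃ q₀ : ℕ, 0 < q₀ ∧
      ∀ (F : Type) [Field F] [Fintype F] [MeasurableSpace F] [DiscreteMeasurableSpace F],
        q₀ ≤ Fintype.card F →
          ∃ Δopt Δmin : ℝ,
            IsGLB (AgeErasure.achievedAges ε F k) Δopt ∧
            IsLeast {D : ℝ | ∃ n : ℕ, k ≤ n ∧ D = AgeErasure.randomCodeAge ε F n k} Δmin ∧
            |Δopt - Δmin| < δ) := by

  refine ⟨fun F _ _ _ _ n hn => ?_, fun n hn δ hδ => ?_, fun δ hδ => ?_⟩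
  · rw [AgeErasure.randomCodeAge_eq hε hk hn]
    exact AgeErasure.ae_hasAverageAge_onTheFly hε hk hn
  · obtain ⟨q₀, hq₀, h⟩ := AgeErasure.exists_forall_abs_randomCodeAge_sub_lt hε hk hn hδ
    refine ⟨q₀, hq₀, fun F _ _ _ _ hF => ⟨?_, h F hF⟩⟩
    filter_upwards [AgeErasure.ae_hasAverageAge_onTheFly hε hk hn] with g hg
    rw [hg.averageAge_eq, ← AgeErasure.randomCodeAge_eq hε hk hn]
    exact h F hF
  -- The minimiser `n₀` of the lower bound does not depend on the field, so `q₀` can be chosen for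
  -- this one blocklength.
  · obtain ⟨n₀, hn₀, hmin₀⟩ := AgeErasure.exists_forall_ge_le
      (f := fun n => AgeErasure.ageLowerBound ε n k)
      fun n hn => AgeErasure.div_two_le_ageLowerBound hε hk hn
    obtain ⟨q₀, hq₀, h⟩ := AgeErasure.exists_forall_abs_randomCodeAge_sub_lt hε hk hn₀ hδ
    refine ⟨q₀, hq₀, fun F _ _ _ _ hF => ?_⟩
    have hlb : ∀ n, k ≤ n →
        AgeErasure.ageLowerBound ε n k ≤ AgeErasure.randomCodeAge ε F n k := by
      intro n hn
      have := AgeErasure.isProbabilityMeasure_randomCode (F := F) hk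
      obtain ⟨g, hg⟩ := (AgeErasure.ae_hasAverageAge_onTheFly (F := F) hε hk hn).exists
      rw [AgeErasure.randomCodeAge_eq hε hk hn]
      exact AgeErasure.ageLowerBound_le hε hk hn
        (AgeErasure.onTheFly_zeroError (hk.trans hn) g) hg
    obtain ⟨n₁, hn₁, hmin₁⟩ := AgeErasure.exists_forall_ge_le
      (f := fun n => AgeErasure.randomCodeAge ε F n k)
      fun n hn => (AgeErasure.div_two_le_ageLowerBound hε hk hn).trans (hlb n hn)
    have hlow : AgeErasure.ageLowerBound ε n₀ k ∈
        lowerBounds (AgeErasure.achievedAges ε F k) := by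
      rintro D ⟨n, hn, S, hS, hD⟩
      exact (hmin₀ n hn).trans (AgeErasure.ageLowerBound_le hε hk hn hS hD)
    have hmem := AgeErasure.randomCodeAge_mem_achievedAges (F := F) hε hk hn₁
    have hglb := isGLB_csInf ⟨_, hmem⟩ ⟨_, hlow⟩
    refine ⟨_, _, hglb, ⟨⟨n₁, hn₁, rfl⟩, ?_⟩, ?_⟩
    · rintro D ⟨n, hn, rfl⟩
      exact hmin₁ n hn
    -- Both ages lie between the lower bound at `n₀` and the random-code age at `n₀`, which are less
    -- than `δ` apart.
    · have h1 := hglb.1 hmem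
      have h2 := hglb.2 hlow
      have h3 := hmin₁ n₀ hn₀
      have h4 := abs_lt.1 (h F hF)
      rw [abs_lt]
      constructor <;> linarith
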